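/- Let $M=(|M|,\mathcal O_M)$ be a real supermanifold of finite dimension $p|q$, let $Q_1,Q_2\in\mathsf{Vect}(M)$ be odd vector fields and $P\in\mathsf{Vect}(M)$ an even one with $$Q_1^2=Q_2^2=0,\qquad \{Q_1,Q_2\}=P,\qquad [P,Q_1]=[P,Q_2]=0,$$ and let $\boldsymbol\rho$ be a Berezin volume on $M$, that is, an even, nowhere vanishing section of the Berezinian line bundle: in coordinates $x^a$ of parity $\tilde a$ it is $D[x]\,\rho(x)$ with $\rho(x)$ even and invertible, and $D[y]=D[x]\,\mathrm{Ber}(\partial y/\partial x)$. For a homogeneous vector field $X=X^a\partial_a$ of parity $\tilde X$ the Lie derivative is $L_X\boldsymbol\rho=D[x]\sum_a(-1)^{\tilde a(\tilde X+1)}\partial_a(X^a\rho)$, and the divergence is defined by $\boldsymbol\rho\,\mathrm{Div}_{\boldsymbol\rho}X=L_X\boldsymbol\rho$. Assume that the modular classes of $Q_1$ and $Q_2$ both vanish, i.e. there are Berezin volumes $\boldsymbol\rho_1,\boldsymbol\rho_2$ with $\mathrm{Div}_{\boldsymbol\rho_1}Q_1=0$ and $\mathrm{Div}_{\boldsymbol\rho_2}Q_2=0$,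 and that there is an even function $\psi\in C^\infty(M)=\mathcal O_M(|M|)$ with $$\mathrm{Div}_{\boldsymbol\rho_1}Q_2=Q_2(\psi)\qquad\text{and}\qquad Q_1(\psi)=0.$$ Then there is a Berezin volume $\boldsymbol\rho'$ on $M$ that is invariant under both supercharges $Q_\pm:=Q_1\pm Q_2$, i.e. $L_{Q_+}\boldsymbol\rho'=0$ and $L_{Q_-}\boldsymbol\rho'=0$. -/

import Mathlib

open CategoryTheory TopologicalSpace Opposite
open scoped ContDiff TensorProduct

universe u

noncomputable section

namespace SuperGeometry

/-! ## The local model `C^∞(W) ⊗ Λ(ℝ^q)` over an open set `W ⊆ ℝ^p` -/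

/-- The underlying space `ℝ^p` of the superspace `ℝ^{p|q}`. -/
abbrev Body (p : ℕ) : Type := EuclideanSpace ℝ (Fin p)

/-- Extension by zero of a function defined on the open set `W`. It is only ever used
at points of the open set `W`, where neither smoothness nor derivatives see the value chosen
outside of `W`. -/
def zeroExtend {p : ℕ} {W : Opens (Body p)} (f : W → ℝ) : Body p → ℝ :=
  Function.extend Subtype.val f 0

theorem zeroExtend_apply {p : ℕ} {W : Opens (Body p)} (f : W → ℝ) (x : W) :
    zeroExtend f x = f x :=
  Subtype.val_injective.extend_apply f 0 x

theorem contDiffOn_zeroExtend {p : ℕ} {W : Opens (Body p)} {f : W → ℝ} {g : Body p → ℝ}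
    {V : Set (Body p)} (hg : ContDiffOn ℝ ∞ g V) (hV : V ⊆ W)
    (h : ∀ x : W, (x : Body p) ∈ V → f x = g x) :
    ContDiffOn ℝ ∞ (zeroExtend f) V :=
  hg.congr fun x hx => by rw [zeroExtend_apply f ⟨x, hV hx⟩, h ⟨x, hV hx⟩ hx]

/-- The algebra `C^∞(W)` of smooth real functions on the open set `W ⊆ ℝ^p`. -/
def smoothFunctions {p : ℕ} (W : Opens (Body p)) : Subalgebra ℝ (W → ℝ) where
  carrier := {f | ContDiffOn ℝ ∞ (zeroExtend f) W}
  mul_mem' {f g} hf hg := contDiffOn_zeroExtend (hf.mul hg) subset_rfl fun x _ => by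
    simp [zeroExtend_apply]
  add_mem' {f g} hf hg := contDiffOn_zeroExtend (hf.add hg) subset_rfl fun x _ => by
    simp [zeroExtend_apply]
  algebraMap_mem' r :=
    contDiffOn_zeroExtend (contDiffOn_const (c := r)) subset_rfl fun x _ => rfl

/-- Restriction `C^∞(W) → C^∞(W')` for `W' ⊆ W`. -/
def smoothRes {p : ℕ} {W' W : Opens (Body p)} (h : W' ≤ W) :
    smoothFunctions W →ₐ[ℝ] smoothFunctions W' where
  toFun f := ⟨fun x => f.1 ⟨x, h x.2⟩,
    contDiffOn_zeroExtend (f.2.mono h) subset_rfl fun x _ =>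
      (zeroExtend_apply f.1 ⟨x, h x.2⟩).symm⟩
  map_one' := rfl
  map_mul' _ _ := rfl
  map_zero' := rfl
  map_add' _ _ := rfl
  commutes' _ := rfl

/-- The function `x^a ∈ C^∞(W)`. -/
def smoothCoord {p : ℕ} (W : Opens (Body p)) (a : Fin p) : smoothFunctions W :=
  ⟨fun x => (x : Body p) a,
    contDiffOn_zeroExtend (g := fun x : Body p => x a) (by fun_prop) subset_rfl fun _ _ => rfl⟩

/-- The partial derivative `∂/∂x^a` on `C^∞(W)`. -/
def smoothPartial {p : ℕ} (W : Opens (Body p)) (a : Fin p) :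
    smoothFunctions W →ₗ[ℝ] smoothFunctions W where
  toFun f := ⟨fun x => fderiv ℝ (zeroExtend f.1) x (EuclideanSpace.single a 1),
    contDiffOn_zeroExtend
      (g := fun x => fderiv ℝ (zeroExtend f.1) x (EuclideanSpace.single a 1))
      ((ContDiffOn.fderiv_of_isOpen f.2 W.isOpen (m := ∞) (by simp)).clm_apply contDiffOn_const)
      subset_rfl fun _ _ => rfl⟩
  map_add' f g := by
    ext x
    have hd (f : smoothFunctions W) : DifferentiableAt ℝ (zeroExtend f.1) x :=
      (f.2.contDiffAt (W.isOpen.mem_nhds x.2)).differentiableAt (by simp)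
    have : zeroExtend (f + g).1 =ᶠ[nhds (x : Body p)] zeroExtend f.1 + zeroExtend g.1 := by
      filter_upwards [W.isOpen.mem_nhds x.2] with y hy
      have h1 := zeroExtend_apply (f + g).1 ⟨y, hy⟩
      have h2 := zeroExtend_apply f.1 ⟨y, hy⟩
      have h3 := zeroExtend_apply g.1 ⟨y, hy⟩
      simp only at h1 h2 h3
      rw [h1, Pi.add_apply, h2, h3]; rfl
    simp only [this.fderiv_eq, fderiv_add (hd f) (hd g)]
    rfl
  map_smul' r f := by
    ext x
    have hd : DifferentiableAt ℝ (zeroExtend f.1) x :=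
      (f.2.contDiffAt (W.isOpen.mem_nhds x.2)).differentiableAt (by simp)
    have : zeroExtend (r • f).1 =ᶠ[nhds (x : Body p)] r • zeroExtend f.1 := by
      filter_upwards [W.isOpen.mem_nhds x.2] with y hy
      have h1 := zeroExtend_apply (r • f).1 ⟨y, hy⟩
      have h2 := zeroExtend_apply f.1 ⟨y, hy⟩
      simp only at h1 h2
      rw [h1, Pi.smul_apply, h2]; rfl
    simp only [this.fderiv_eq, fderiv_const_smul hd]
    rfl

/-- The Grassmann algebra `Λ(ℝ^q)`. -/
abbrev Grassmann (q : ℕ) : Type := ExteriorAlgebra ℝ (Fin q → ℝ)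

/-- Functions `C^∞(W) ⊗ Λ(ℝ^q)` on the superdomain of dimension `p|q` over `W`. -/
abbrev Model {p : ℕ} (q : ℕ) (W : Opens (Body p)) : Type := smoothFunctions W ⊗[ℝ] Grassmann q

/-- The even (`i = 0`) and odd (`i = 1`) parts of `C^∞(W) ⊗ Λ(ℝ^q)`. -/
def modelPart {p : ℕ} (q : ℕ) (W : Opens (Body p)) (i : ZMod 2) : Submodule ℝ (Model q W) :=
  LinearMap.range (LinearMap.lTensor (smoothFunctions W)
    (CliffordAlgebra.evenOdd (0 : QuadraticForm ℝ (Fin q → ℝ)) i).subtype)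

/-- Restriction of functions on a superdomain. -/
def modelRes {p : ℕ} (q : ℕ) {W' W : Opens (Body p)} (h : W' ≤ W) :
    Model q W →ₐ[ℝ] Model q W' :=
  Algebra.TensorProduct.map (smoothRes h) (AlgHom.id ℝ (Grassmann q))

/-- The index set of the coordinates: `p` even and `q` odd ones. -/
abbrev CoordIndex (p q : ℕ) : Type := Fin p ⊕ Fin q

/-- The Grassmann parity of a coordinate. -/
def coordParity {p q : ℕ} : CoordIndex p q → ZMod 2
  | .inl _ => 0
  | .inr _ => 1

/-- The standard coordinates: `x^a` (even) and `θ^α` (odd). -/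
def modelCoord {p q : ℕ} (W : Opens (Body p)) : CoordIndex p q → Model q W
  | .inl a => smoothCoord W a ⊗ₜ 1
  | .inr α => 1 ⊗ₜ ExteriorAlgebra.ι ℝ (Pi.single α 1)

/-- The (left) partial derivatives `∂/∂x^a` and `∂/∂θ^α`. The latter is contraction with the
`α`-th coordinate form: `∂/∂θ^α (θ^β g) = δ^β_α g - θ^β ∂g/∂θ^α`. -/
def modelPartial {p q : ℕ} (W : Opens (Body p)) : CoordIndex p q → Model q W →ₗ[ℝ] Model q W
  | .inl a => LinearMap.rTensor (Grassmann q) (smoothPartial W a)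
  | .inr α => LinearMap.lTensor (smoothFunctions W)
      (CliffordAlgebra.contractLeft (Q := (0 : QuadraticForm ℝ (Fin q → ℝ)))
        (LinearMap.proj α : (Fin q → ℝ) →ₗ[ℝ] ℝ))

/-! ## Supermanifolds -/

/-- The sign `(-1)^{ij}` of two parities. -/
def koszul (i j : ZMod 2) : ℝ := (-1) ^ (i.val * j.val)

/-- A topological space with a sheaf of supercommutative real superalgebras. -/
structure SuperSpace where
  /-- the underlying topological space -/
  body : TopCat.{u}
  /-- the structure sheaf, a sheaf of associative unital real algebras -/
  sheaf : TopCat.Sheaf (AlgCat.{u} ℝ) body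
  /-- the even and the odd sections -/
  part : ∀ U : Opens body, ZMod 2 → Submodule ℝ (sheaf.presheaf.obj (op U))
  graded : ∀ U, GradedAlgebra (part U)
  res_mem : ∀ {V U : Opens body} (h : V ≤ U) (i : ZMod 2), ∀ f ∈ part U i,
    (sheaf.presheaf.map (homOfLE h).op).hom f ∈ part V i
  supercomm : ∀ (U : Opens body) (i j : ZMod 2), ∀ f ∈ part U i, ∀ g ∈ part U j,
    f * g = koszul i j • (g * f)

namespace SuperSpace

/-- The algebra of sections over the open set `U`. -/
abbrev Sec (S : SuperSpace.{u}) (U : Opens S.body) : Type u := S.sheaf.presheaf.obj (op U)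

/-- Restriction of sections. -/
def res (S : SuperSpace.{u}) {V U : Opens S.body} (h : V ≤ U) : S.Sec U →ₐ[ℝ] S.Sec V :=
  (S.sheaf.presheaf.map (homOfLE h).op).hom

/-- A coordinate chart of dimension `p|q`: an isomorphism between the restriction of the superspace
to an open set `dom` and the superdomain over an open set of `ℝ^p`, that is, a homeomorphism
`φ` of `dom` onto an open set of `ℝ^p` and a parity preserving isomorphism of sheaves of algebras
over it. -/
structure Chart (S : SuperSpace.{u}) (p q : ℕ) where
  dom : Opens S.body
  φ : OpenPartialHomeomorph S.body (Body p)
  source_eq : φ.source = dom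
  iso : ∀ (V : Opens S.body) (h : V ≤ dom), S.Sec V ≃ₐ[ℝ]
    Model q (⟨φ '' V, φ.isOpen_image_of_subset_source V.isOpen
      (fun _ hx => source_eq ▸ h hx)⟩ : Opens (Body p))
  iso_mem : ∀ (V : Opens S.body) (h : V ≤ dom) (i : ZMod 2), ∀ f ∈ S.part V i,
    iso V h f ∈ modelPart q _ i
  iso_res : ∀ (V' V : Opens S.body) (hV : V' ≤ V) (h : V ≤ dom) (f : S.Sec V),
    iso V' (hV.trans h) (S.res hV f) = modelRes q (Set.image_mono hV) (iso V h f)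

namespace Chart

variable {S : SuperSpace.{u}} {p q : ℕ}

/-- The coordinates of the chart, as sections over an open subset `V` of the chart domain. -/
def coord (c : S.Chart p q) (V : Opens S.body) (h : V ≤ c.dom) (a : CoordIndex p q) : S.Sec V :=
  (c.iso V h).symm (modelCoord _ a)

/-- The partial derivatives of the chart, over an open subset `V` of the chart domain. -/
def pderiv (c : S.Chart p q) (V : Opens S.body) (h : V ≤ c.dom) (a : CoordIndex p q) :
    S.Sec V →ₗ[ℝ] S.Sec V :=
  (c.iso V h).symm.toLinearMap ∘ₗ modelPartial _ a ∘ₗ (c.iso V h).toLinearMap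

/-- The Jacobian matrix `(∂y^b/∂x^a)` (row `a`, column `b`) of two charts `x = c` and `y = c'`
over the intersection of their domains. -/
def jacobian (c c' : S.Chart p q) :
    Matrix (CoordIndex p q) (CoordIndex p q) (S.Sec (c.dom ⊓ c'.dom)) :=
  Matrix.of fun a b => c.pderiv _ inf_le_left a (c'.coord _ inf_le_right b)

end Chart

end SuperSpace

/-- A real supermanifold of dimension `p|q`: a Hausdorff second countable space with a sheaf of
supercommutative superalgebras that is locally isomorphic to `C^∞(W) ⊗ Λ(ℝ^q)`, `W ⊆ ℝ^p` open. -/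
structure Supermanifold (p q : ℕ) extends SuperSpace.{u} where
  t2 : T2Space body
  secondCountable : SecondCountableTopology body
  exists_chart : ∀ x : body, ∃ c : toSuperSpace.Chart p q, x ∈ c.dom

/-! ## Vector fields -/

/-- A homogeneous vector field of parity `j`: a graded derivation of the structure sheaf. -/
@[ext]
structure VectorField {p q : ℕ} (M : Supermanifold.{u} p q) (j : ZMod 2) where
  app : ∀ U : Opens M.body, M.Sec U →ₗ[ℝ] M.Sec U
  app_res : ∀ {V U : Opens M.body} (h : V ≤ U) (f : M.Sec U),
    app V (M.res h f) = M.res h (app U f)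
  app_mem : ∀ (U : Opens M.body) (i : ZMod 2), ∀ f ∈ M.part U i, app U f ∈ M.part U (i + j)
  leibniz : ∀ (U : Opens M.body) (i : ZMod 2), ∀ f ∈ M.part U i, ∀ g : M.Sec U,
    app U (f * g) = app U f * g + koszul j i • (f * app U g)

instance {p q : ℕ} (M : Supermanifold.{u} p q) (j : ZMod 2) : Add (VectorField M j) where
  add X Y :=
    { app := fun U => X.app U + Y.app U
      app_res := fun h f => by simp [X.app_res h f, Y.app_res h f]
      app_mem := fun U i f hf => (M.part U (i + j)).add_mem (X.app_mem U i f hf) (Y.app_mem U i f hf)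
      leibniz := fun U i f hf g => by
        simp only [LinearMap.add_apply, X.leibniz U i f hf g, Y.leibniz U i f hf g, add_mul,
          mul_add, smul_add]
        abel }

instance {p q : ℕ} (M : Supermanifold.{u} p q) (j : ZMod 2) : Sub (VectorField M j) where
  sub X Y :=
    { app := fun U => X.app U - Y.app U
      app_res := fun h f => by simp [X.app_res h f, Y.app_res h f]
      app_mem := fun U i f hf => (M.part U (i + j)).sub_mem (X.app_mem U i f hf) (Y.app_mem U i f hf)
      leibniz := fun U i f hf g => by
        simp only [LinearMap.sub_apply, X.leibniz U i f hf g, Y.leibniz U i f hf g, sub_mul,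
          mul_sub, smul_sub]
        abel }

/-! ## Berezin volumes -/

/-- The determinant by the Leibniz formula, for matrices whose entries commute with each other
inside a ring that need not be commutative. -/
def leibnizDet {n : ℕ} {R : Type*} [Ring R] (A : Matrix (Fin n) (Fin n) R) : R :=
  ∑ σ : Equiv.Perm (Fin n), Equiv.Perm.sign σ • (List.ofFn fun i => A (σ i) i).prod

theorem leibnizDet_eq_det {n : ℕ} {R : Type*} [CommRing R] (A : Matrix (Fin n) (Fin n) R) :
    leibnizDet A = A.det := by
  simp [leibnizDet, Matrix.det_apply, List.prod_ofFn]

/-- The Berezinian `det (A - B D⁻¹ C) (det D)⁻¹` of an even invertible supermatrix with blocks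
`A` (even-even), `B`, `C`, `D` (odd-odd). Here `A`, `D` and `B D⁻¹ C` have even, hence
commuting, entries. -/
def berezinian {p q : ℕ} {R : Type*} [Ring R]
    (J : Matrix (CoordIndex p q) (CoordIndex p q) R) : R :=
  leibnizDet (J.toBlocks₁₁ - J.toBlocks₁₂ * Ring.inverse J.toBlocks₂₂ * J.toBlocks₂₁) *
    Ring.inverse (leibnizDet J.toBlocks₂₂)

/-- A Berezin volume `ρ`: an even, nowhere vanishing section of the Berezinian line bundle.
In a chart `x` it reads `ρ = D[x] ρ_x` with `ρ_x` even and invertible; since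
`D[y] = D[x] Ber(∂y/∂x)`, the coefficients obey `ρ_x = Ber(∂y/∂x) ρ_y` on overlaps. -/
structure BerezinVolume {p q : ℕ} (M : Supermanifold.{u} p q) where
  coeff : ∀ c : M.Chart p q, M.Sec c.dom
  even : ∀ c, coeff c ∈ M.part c.dom 0
  nowhere_vanishing : ∀ c, IsUnit (coeff c)
  transform : ∀ c c' : M.Chart p q, M.res (inf_le_left : c.dom ⊓ c'.dom ≤ c.dom) (coeff c) =
    berezinian (c.jacobian c') * M.res (inf_le_right : c.dom ⊓ c'.dom ≤ c'.dom) (coeff c')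

/-- The Lie derivative `L_X ρ` of a Berezin volume, given by its coefficients in all charts:
`L_X ρ = D[x] ∑_a (-1)^{ã (X̃ + 1)} ∂(X^a ρ_x)/∂x^a`, where `X^a = X(x^a)`. -/
def lieDerivative {p q : ℕ} {M : Supermanifold.{u} p q} {j : ZMod 2} (X : VectorField M j)
    (ρ : BerezinVolume M) : ∀ c : M.Chart p q, M.Sec c.dom :=
  fun c => ∑ a : CoordIndex p q, koszul (coordParity a) (j + 1) •
    c.pderiv c.dom le_rfl a (X.app c.dom (c.coord c.dom le_rfl a) * ρ.coeff c)

/-- `C^∞(M)`, the algebra of global functions. -/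
abbrev Functions {p q : ℕ} (M : Supermanifold.{u} p q) : Type u := M.Sec ⊤

/-- The function `d` is the divergence of `X` with respect to `ρ`, that is, `ρ d = L_X ρ`. -/
def IsDivergence {p q : ℕ} {M : Supermanifold.{u} p q} {j : ZMod 2} (ρ : BerezinVolume M)
    (X : VectorField M j) (d : Functions M) : Prop :=
  ∀ c : M.Chart p q, ρ.coeff c * M.res le_top d = lieDerivative X ρ c

/-- An `N = 2` supermanifold with a volume: odd vector fields `Q₁`, `Q₂` and an even one `P` with
`Q₁² = Q₂² = 0`, `{Q₁, Q₂} = P`, `[P, Q₁] = [P, Q₂] = 0`, and a Berezin volume. -/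
structure N2SupermanifoldWithVolume (p q : ℕ) where
  M : Supermanifold.{u} p q
  Q₁ : VectorField M 1
  Q₂ : VectorField M 1
  P : VectorField M 0
  Q₁_sq : ∀ U, Q₁.app U ∘ₗ Q₁.app U = 0
  Q₂_sq : ∀ U, Q₂.app U ∘ₗ Q₂.app U = 0
  anticomm : ∀ U, Q₁.app U ∘ₗ Q₂.app U + Q₂.app U ∘ₗ Q₁.app U = P.app U
  comm₁ : ∀ U, P.app U ∘ₗ Q₁.app U - Q₁.app U ∘ₗ P.app U = 0
  comm₂ : ∀ U, P.app U ∘ₗ Q₂.app U - Q₂.app U ∘ₗ P.app U = 0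
  volume : BerezinVolume M

end SuperGeometry

end

open SuperGeometry

/-!
The invariant volume is `ρ' = ρ₁ e^{-ψ}`. For an even function `g` the Leibniz rule gives
`L_X (ρ g) = (L_X ρ) g + ρ X(g)` (`lieDerivative_rescale`), and `X(e^{-ψ}) = -X(ψ) e^{-ψ}`
(`IsExp.app_eq`). Hence `X` preserves `ρ e^{-ψ}` whenever `Div_ρ X = X(ψ)`
(`lieDerivative_rescale_eq_zero`). This applies to `ρ = ρ₁` and `X = Q₂`, and also to `X = Q₁`,
where both sides vanish; the Lie derivative is additive in `X`, so `Q₁ ± Q₂` preserve `ρ'` as well.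

Two ingredients rest on the local structure of supermanifolds.

* In a chart, `X = ∑ X(x^a) ∂_a` (`VectorField.app_eq_sum`). By Hadamard's lemma a section near `x`
  is its value at `x` plus an element of the ideal generated by the centred coordinates, and the
  difference of both sides is a derivation which kills constants and coordinates. By induction it
  takes values that vanish at `x` to every order. A section that vanishes to order `q + 1` at all
  points is zero (`eq_zero_of_mem_vanishingIdeal`), because the augmentation ideal of `Λ(ℝ^q)` is
  nilpotent and a smooth function is determined by its values.

* Every even function has an exponential (`exists_isExp`). In order to glue the exponentials
  `e^u ∑ n^k / k!` of `f = u + n` in charts, exponentials are characterized by their Taylor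
  expansions at all points, in terms of the values and the vanishing orders of sections. These do
  not depend on charts: the value of `f` at `x` is the number `r` such that `f - r` is not invertible
  in any neighbourhood of `x` (`Chart.eval_eq_eval`). Uniqueness, multiplicativity and the chain rule
  all follow from the fact that sections are determined by their expansions to order `q + 1`.
-/

noncomputable section

namespace SuperGeometry

/-! ### Powers of ideals -/

theorem map_mem_ideal_pow {A B : Type*} [Ring A] [Ring B] (φ : A →+* B) {I : Ideal A} {J : Ideal B}
    (h : ∀ a ∈ I, φ a ∈ J) {n : ℕ} : ∀ a ∈ I ^ n, φ a ∈ J ^ n := by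
  induction n with
  | zero => intro a _; rw [Submodule.pow_zero, Ideal.one_eq_top]; trivial
  | succ n ih =>
    intro a ha
    rw [Submodule.pow_succ] at ha ⊢
    induction ha using Submodule.mul_induction_on' with
    | mem_mul_mem b hb c hc =>
      rw [map_mul]
      exact Ideal.mul_mem_mul (ih b hb) (h c hc)
    | add b _ c _ hb hc =>
      rw [map_add]
      exact add_mem hb hc

theorem pow_mem_ideal_pow {A : Type*} [Ring A] {I : Ideal A} {a : A} (h : a ∈ I) (n : ℕ) :
    a ^ n ∈ I ^ n := by
  induction n with
  | zero => rw [Submodule.pow_zero, Ideal.one_eq_top]; trivial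
  | succ n ih =>
    rw [pow_succ, Submodule.pow_succ]
    exact Ideal.mul_mem_mul ih h

/-! ### The augmentation ideal of the Grassmann algebra -/

/-- The part `⨁_{k ≥ n} Λ^k(ℝ^q)` of the Grassmann algebra. -/
def grassmannFiltration (q n : ℕ) : Submodule ℝ (Grassmann q) :=
  ⨆ k : ℕ, ⨆ _ : n ≤ k, ⋀[ℝ]^k (Fin q → ℝ)

theorem mul_mem_grassmannFiltration {q m n : ℕ} {a b : Grassmann q}
    (ha : a ∈ grassmannFiltration q m) (hb : b ∈ grassmannFiltration q n) :
    a * b ∈ grassmannFiltration q (m + n) := by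
  have h : grassmannFiltration q m * grassmannFiltration q n ≤ grassmannFiltration q (m + n) := by
    simp only [grassmannFiltration, Submodule.iSup_mul, Submodule.mul_iSup, iSup_le_iff]
    intro j hj k hk
    exact (pow_add (LinearMap.range (ExteriorAlgebra.ι ℝ (M := Fin q → ℝ))) k j).ge.trans
      (le_iSup₂_of_le (f := fun i (_ : m + n ≤ i) => ⋀[ℝ]^i (Fin q → ℝ)) (k + j) (by omega) le_rfl)
  exact h (Submodule.mul_mem_mul ha hb)

theorem grassmannFiltration_eq_bot (q : ℕ) : grassmannFiltration q (q + 1) = ⊥ := by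
  simp only [grassmannFiltration, iSup_eq_bot]
  intro k hk
  apply Submodule.finrank_eq_zero.mp
  rw [exteriorPower.finrank_eq, Module.finrank_fin_fun, Nat.choose_eq_zero_of_lt hk]

theorem sub_algebraMapInv_mem_grassmannFiltration {q : ℕ} (a : Grassmann q) :
    a - algebraMap ℝ _ (ExteriorAlgebra.algebraMapInv a) ∈ grassmannFiltration q 1 := by
  induction a using ExteriorAlgebra.induction with
  | algebraMap r => simp [ExteriorAlgebra.algebraMap_leftInverse _ r]
  | ι v =>
    refine (le_iSup₂_of_le 1 le_rfl le_rfl : _ ≤ grassmannFiltration q 1) ?_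
    simp [ExteriorAlgebra.algebraMapInv]
  | mul a b ha hb =>
    have hab := mul_mem_grassmannFiltration ha hb
    have hle : grassmannFiltration q (1 + 1) ≤ grassmannFiltration q 1 :=
      iSup₂_le fun k hk => le_iSup₂_of_le k (by omega) le_rfl
    have key : a * b - algebraMap ℝ _ (ExteriorAlgebra.algebraMapInv (a * b)) =
        (a - algebraMap ℝ _ (ExteriorAlgebra.algebraMapInv a)) *
          (b - algebraMap ℝ _ (ExteriorAlgebra.algebraMapInv b)) +
        ExteriorAlgebra.algebraMapInv b • (a - algebraMap ℝ _ (ExteriorAlgebra.algebraMapInv a)) +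
        ExteriorAlgebra.algebraMapInv a •
          (b - algebraMap ℝ _ (ExteriorAlgebra.algebraMapInv b)) := by
      rw [Algebra.smul_def, Algebra.smul_def, Algebra.commutes, map_mul, map_mul]
      noncomm_ring
    rw [key]
    exact add_mem (add_mem (hle hab) (Submodule.smul_mem _ _ ha)) (Submodule.smul_mem _ _ hb)
  | add a b ha hb =>
    have := add_mem ha hb
    rwa [sub_add_sub_comm, ← map_add, ← map_add] at this

/-- Any product of `q + 1` elements without constant term vanishes in `Λ(ℝ^q)`. -/
theorem augmentationIdeal_pow_eq_bot (q : ℕ) :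
    RingHom.ker (ExteriorAlgebra.algebraMapInv : Grassmann q →ₐ[ℝ] ℝ) ^ (q + 1) = ⊥ := by
  have h : ∀ n, ∀ a ∈ RingHom.ker (ExteriorAlgebra.algebraMapInv : Grassmann q →ₐ[ℝ] ℝ) ^ n,
      a ∈ grassmannFiltration q n := by
    intro n
    induction n with
    | zero =>
      intro a _
      have h0 : algebraMap ℝ (Grassmann q) (ExteriorAlgebra.algebraMapInv a) ∈
          grassmannFiltration q 0 :=
        (le_iSup₂_of_le 0 le_rfl le_rfl : _ ≤ grassmannFiltration q 0)
          (Submodule.algebraMap_mem _)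
      have hle : grassmannFiltration q 1 ≤ grassmannFiltration q 0 :=
        iSup₂_le fun k hk => le_iSup₂_of_le k (by omega) le_rfl
      simpa using add_mem (hle (sub_algebraMapInv_mem_grassmannFiltration a)) h0
    | succ n ih =>
      intro a ha
      rw [Submodule.pow_succ] at ha
      induction ha using Submodule.mul_induction_on' with
      | mem_mul_mem b hb c hc =>
        have hc' := sub_algebraMapInv_mem_grassmannFiltration c
        rw [show ExteriorAlgebra.algebraMapInv c = 0 from hc, map_zero, sub_zero] at hc'
        exact mul_mem_grassmannFiltration (ih b hb) hc'
      | add b _ c _ hb hc => exact add_mem hb hc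
  rw [eq_bot_iff]
  intro a ha
  have := h _ a ha
  rwa [grassmannFiltration_eq_bot] at this

/-! ### Points of a superdomain -/

section Points

variable {p q : ℕ} {W : Opens (Body p)}

-- Without this shortcut the search for ring structures on `Model q W` is too slow.
instance : Ring (Model q W) := Algebra.TensorProduct.instRing

/-- Evaluation of a smooth function at a point. -/
def smoothEval (y : W) : smoothFunctions W →ₐ[ℝ] ℝ :=
  (Pi.evalAlgHom ℝ (fun _ : W => ℝ) y).comp (smoothFunctions W).val

/-- Evaluation at a point `y` of the coefficients of a function on a superdomain. -/
def modelFiber (q : ℕ) (y : W) : Model q W →ₐ[ℝ] Grassmann q :=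
  Algebra.TensorProduct.lift ((Algebra.ofId ℝ (Grassmann q)).comp (smoothEval y))
    (AlgHom.id ℝ (Grassmann q)) fun u w =>
      (Algebra.commutes (u.1 y) w : algebraMap ℝ (Grassmann q) (u.1 y) * w = _)

theorem modelFiber_tmul (y : W) (u : smoothFunctions W) (w : Grassmann q) :
    modelFiber q y (u ⊗ₜ w) = u.1 y • w := by
  rw [Algebra.smul_def]
  simp [modelFiber, smoothEval, Algebra.ofId_apply]

/-- The value of a function on a superdomain at the point `y`. -/
def modelEval (q : ℕ) (y : W) : Model q W →ₐ[ℝ] ℝ :=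
  ExteriorAlgebra.algebraMapInv.comp (modelFiber q y)

theorem modelEval_tmul (y : W) (u : smoothFunctions W) (w : Grassmann q) :
    modelEval q y (u ⊗ₜ w) = u.1 y * ExteriorAlgebra.algebraMapInv w := by
  simp [modelEval, modelFiber_tmul]

theorem eq_zero_of_modelFiber_eq_zero {f : Model q W} (h : ∀ y : W, modelFiber q y f = 0) :
    f = 0 := by
  let b := Module.Free.chooseBasis ℝ (Grassmann q)
  apply (TensorProduct.equivFinsuppOfBasisRight (M := smoothFunctions W) b).injective
  rw [map_zero]
  ext i y
  have key : ∀ g : Model q W,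
      (TensorProduct.equivFinsuppOfBasisRight (M := smoothFunctions W) b g i).1 y =
        b.repr (modelFiber q y g) i := by
    intro g
    induction g using TensorProduct.induction_on with
    | zero => simp
    | tmul u w =>
      rw [modelFiber_tmul, TensorProduct.equivFinsuppOfBasisRight_apply_tmul_apply]
      simp [mul_comm]
    | add g g' h h' => simp only [map_add, Finsupp.add_apply, ← h, ← h']; rfl
  rw [key, h y]
  simp

theorem modelFiber_eq_zero_of_mem_pow {y : W} {f : Model q W}
    (hf : f ∈ RingHom.ker (modelEval q y) ^ (q + 1)) : modelFiber q y f = 0 := by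
  have h := map_mem_ideal_pow (modelFiber q y : Model q W →+* Grassmann q)
    (J := RingHom.ker (ExteriorAlgebra.algebraMapInv : Grassmann q →ₐ[ℝ] ℝ))
    (fun g hg => hg) f hf
  rwa [augmentationIdeal_pow_eq_bot] at h

/-- The body of a function on a superdomain: the even variables are kept, the odd ones set to
zero. -/
def modelBody : Model q W →ₐ[ℝ] smoothFunctions W :=
  Algebra.TensorProduct.lift (AlgHom.id ℝ _)
    ((Algebra.ofId ℝ (smoothFunctions W)).comp ExteriorAlgebra.algebraMapInv)
    fun _ _ => Commute.all _ _

theorem modelBody_apply (f : Model q W) (y : W) : (modelBody f).1 y = modelEval q y f := by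
  induction f using TensorProduct.induction_on with
  | zero => simp
  | tmul u w => 
    rw [modelEval_tmul, modelBody, Algebra.TensorProduct.lift_tmul]
    rfl
  | add f g hf hg => rw [map_add, map_add, ← hf, ← hg]; rfl

/-- A function on a superdomain differs from its body by a nilpotent one. -/
theorem sub_modelBody_pow (f : Model q W) : (f - modelBody f ⊗ₜ 1) ^ (q + 1) = 0 := by
  generalize hn : f - modelBody f ⊗ₜ 1 = n
  refine eq_zero_of_modelFiber_eq_zero fun y => modelFiber_eq_zero_of_mem_pow
    (pow_mem_ideal_pow ?_ _)
  rw [RingHom.mem_ker, ← hn, map_sub, modelEval_tmul, modelBody_apply, map_one, mul_one, sub_self]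

/-- A function with nowhere vanishing body is the sum of a unit and a commuting nilpotent. -/
theorem isUnit_of_modelEval_ne_zero {f : Model q W} (h : ∀ y : W, modelEval q y f ≠ 0) :
    IsUnit f := by
  have hu : IsUnit (modelBody f) := by
    refine .of_mul_eq_one (⟨fun y => ((modelBody f).1 y)⁻¹, ?_⟩ : smoothFunctions W) ?_
    · refine contDiffOn_zeroExtend (g := fun y => (zeroExtend (modelBody f).1 y)⁻¹)
        ((modelBody f).2.inv fun y hy => ?_) subset_rfl fun y _ => ?_
      · rw [zeroExtend_apply (modelBody f).1 ⟨y, hy⟩, modelBody_apply]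
        exact h _
      · rw [zeroExtend_apply]
    · ext y
      exact mul_inv_cancel₀ (by rw [modelBody_apply]; exact h y)
  have hu' : IsUnit ((modelBody f ⊗ₜ 1 : Model q W)) :=
    hu.map (Algebra.TensorProduct.includeLeft : smoothFunctions W →ₐ[ℝ] Model q W)
  have hc : Commute (f - modelBody f ⊗ₜ 1) (modelBody f ⊗ₜ 1 : Model q W) := by
    have : ∀ (u : smoothFunctions W) (g : Model q W), Commute g (u ⊗ₜ 1) := by
      intro u g
      induction g using TensorProduct.induction_on with
      | zero => exact Commute.zero_left _
      | tmul v w => simp [Commute, SemiconjBy, mul_comm]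
      | add g g' h h' => exact h.add_left h'
    exact this _ _
  have := (show IsNilpotent (R := Model q W) (f - modelBody f ⊗ₜ 1) from
    ⟨q + 1, sub_modelBody_pow f⟩).isUnit_add_left_of_commute hu' hc
  rwa [add_sub_cancel] at this

end Points

/-! ### Partial derivatives and parities on a superdomain -/

section Partial

variable {p q : ℕ} {W W' : Opens (Body p)}

theorem zeroExtend_eventuallyEq {f : W → ℝ} {g : Body p → ℝ} {x : Body p} (hx : x ∈ W)
    (h : ∀ y : W, f y = g y) : zeroExtend f =ᶠ[nhds x] g := by
  filter_upwards [W.isOpen.mem_nhds hx] with y hy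
  rw [zeroExtend_apply f ⟨y, hy⟩, h]

theorem differentiableAt_zeroExtend (u : smoothFunctions W) {x : Body p} (hx : x ∈ W) :
    DifferentiableAt ℝ (zeroExtend u.1) x :=
  (u.2.contDiffAt (W.isOpen.mem_nhds hx)).differentiableAt (by simp)

theorem smoothPartial_apply (a : Fin p) (u : smoothFunctions W) (x : W) :
    (smoothPartial W a u).1 x = fderiv ℝ (zeroExtend u.1) x (EuclideanSpace.single a 1) := rfl

theorem smoothPartial_mul (a : Fin p) (u v : smoothFunctions W) :
    smoothPartial W a (u * v) = smoothPartial W a u * v + u * smoothPartial W a v := by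
  ext x
  change (smoothPartial W a (u * v)).1 x =
    (smoothPartial W a u).1 x * v.1 x + u.1 x * (smoothPartial W a v).1 x
  simp only [smoothPartial_apply]
  have h : zeroExtend (u * v).1 =ᶠ[nhds (x : Body p)] zeroExtend u.1 * zeroExtend v.1 :=
    zeroExtend_eventuallyEq x.2 fun y => by
      rw [Pi.mul_apply, zeroExtend_apply, zeroExtend_apply]; rfl
  rw [h.fderiv_eq, fderiv_mul (differentiableAt_zeroExtend u x.2)
    (differentiableAt_zeroExtend v x.2)]
  simp only [zeroExtend_apply, add_apply, smul_apply,
    smul_eq_mul]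
  ring

theorem smoothPartial_res (h : W' ≤ W) (a : Fin p) (u : smoothFunctions W) :
    smoothPartial W' a (smoothRes h u) = smoothRes h (smoothPartial W a u) := by
  ext x
  change fderiv ℝ (zeroExtend (smoothRes h u).1) x _ = fderiv ℝ (zeroExtend u.1) x _
  rw [(zeroExtend_eventuallyEq x.2 fun y => (zeroExtend_apply u.1 ⟨y, h y.2⟩).symm :
    zeroExtend (smoothRes h u).1 =ᶠ[nhds (x : Body p)] zeroExtend u.1).fderiv_eq]

theorem smoothPartial_coord (a b : Fin p) :
    smoothPartial W a (smoothCoord W b) = if a = b then 1 else 0 := by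
  ext x
  have h : zeroExtend (smoothCoord W b).1 =ᶠ[nhds (x : Body p)]
      (EuclideanSpace.proj b : Body p →L[ℝ] ℝ) := zeroExtend_eventuallyEq x.2 fun y => rfl
  rw [smoothPartial_apply, h.fderiv_eq, ContinuousLinearMap.fderiv]
  by_cases hab : a = b
  · subst hab; simp
  · rw [if_neg hab]
    simp [Ne.symm hab]

/-- Contraction with a covector is an odd derivation of the Grassmann algebra. -/
theorem contractLeft_mul (d : Module.Dual ℝ (Fin q → ℝ)) (a b : Grassmann q) :
    CliffordAlgebra.contractLeft (Q := (0 : QuadraticForm ℝ (Fin q → ℝ))) d (a * b) =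
      CliffordAlgebra.contractLeft (Q := (0 : QuadraticForm ℝ (Fin q → ℝ))) d a * b +
      CliffordAlgebra.involute a *
        CliffordAlgebra.contractLeft (Q := (0 : QuadraticForm ℝ (Fin q → ℝ))) d b := by
  induction a using CliffordAlgebra.left_induction with
  | algebraMap r =>
    rw [CliffordAlgebra.contractLeft_algebraMap_mul, CliffordAlgebra.contractLeft_algebraMap,
      zero_mul, zero_add, AlgHom.commutes]
  | add x y hx hy => simp only [add_mul, map_add, hx, hy]; abel
  | ι_mul x m hx =>
    rw [mul_assoc, CliffordAlgebra.contractLeft_ι_mul, hx, CliffordAlgebra.contractLeft_ι_mul,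
      map_mul, CliffordAlgebra.involute_ι]
    simp only [mul_add, sub_mul, smul_mul_assoc, mul_assoc, neg_mul]
    abel

/-- The parity automorphism: the identity on even and minus the identity on odd functions. -/
def modelInvolute : Model q W →ₐ[ℝ] Model q W :=
  Algebra.TensorProduct.map (AlgHom.id ℝ _)
    (CliffordAlgebra.involute (Q := (0 : QuadraticForm ℝ (Fin q → ℝ))))

theorem modelInvolute_tmul (u : smoothFunctions W) (w : Grassmann q) :
    modelInvolute (u ⊗ₜ[ℝ] w : Model q W) =
      u ⊗ₜ CliffordAlgebra.involute (Q := (0 : QuadraticForm ℝ (Fin q → ℝ))) w := rfl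

theorem koszul_zero_right (i : ZMod 2) : koszul i 0 = 1 := by simp [koszul]

theorem koszul_zero_left (i : ZMod 2) : koszul 0 i = 1 := by simp [koszul]

theorem koszul_one_one : koszul 1 1 = -1 := by simp [koszul, ZMod.val_one]

theorem koszul_mul_koszul (i j k : ZMod 2) : koszul i k * koszul (i + j) k = koszul j k := by
  have h : ∀ i j k : ZMod 2, Even (i.val * k.val + (i + j).val * k.val + j.val * k.val) := by
    decide
  have h1 : koszul i k * koszul (i + j) k * koszul j k = 1 := by
    rw [koszul, koszul, koszul, ← pow_add, ← pow_add]
    exact (h i j k).neg_one_pow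
  have h2 : koszul j k * koszul j k = 1 := by
    rw [koszul, ← pow_add]
    exact Even.neg_one_pow ⟨_, rfl⟩
  rw [← mul_one (koszul i k * _), ← h2, ← mul_assoc, h1, one_mul]

theorem modelInvolute_of_mem {i : ZMod 2} {f : Model q W} (hf : f ∈ modelPart q W i) :
    modelInvolute f = koszul 1 i • f := by
  obtain ⟨g, rfl⟩ := hf
  induction g using TensorProduct.induction_on with
  | zero => simp
  | tmul u w =>
    rw [LinearMap.lTensor_tmul, modelInvolute_tmul]
    obtain rfl | rfl : i = 0 ∨ i = 1 := by
      clear w; revert i; decide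
    · rw [koszul_zero_right, one_smul, Submodule.subtype_apply,
        CliffordAlgebra.involute_eq_of_mem_even w.2]
    · rw [koszul_one_one, Submodule.subtype_apply, CliffordAlgebra.involute_eq_of_mem_odd w.2,
        TensorProduct.tmul_neg, neg_one_smul]
  | add g g' hg hg' => rw [map_add, map_add, hg, hg', smul_add]

theorem eq_zero_of_mem_modelPart {f : Model q W} (h0 : f ∈ modelPart q W 0)
    (h1 : f ∈ modelPart q W 1) : f = 0 := by
  have h := (modelInvolute_of_mem h0).symm.trans (modelInvolute_of_mem h1)
  rw [koszul_zero_right, koszul_one_one, one_smul, neg_one_smul] at h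
  have h2 : (2 : ℝ) • f = 0 := by rw [two_smul, ← eq_neg_iff_add_eq_zero]; exact h
  rw [← one_smul ℝ f, show (1 : ℝ) = 2⁻¹ * 2 by norm_num, mul_smul, h2, smul_zero]

theorem modelCoord_mem (a : CoordIndex p q) : modelCoord W a ∈ modelPart q W (coordParity a) := by
  rcases a with a | α
  · exact ⟨smoothCoord W a ⊗ₜ ⟨1, SetLike.one_mem_graded _⟩, rfl⟩
  · exact ⟨1 ⊗ₜ ⟨_, CliffordAlgebra.ι_mem_evenOdd_one _ (Pi.single α 1)⟩, rfl⟩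

theorem tmul_one_mem_modelPart (u : smoothFunctions W) :
    (u ⊗ₜ 1 : Model q W) ∈ modelPart q W 0 :=
  ⟨u ⊗ₜ ⟨1, SetLike.one_mem_graded _⟩, rfl⟩

theorem modelPartial_mul (a : CoordIndex p q) {i : ZMod 2} {f : Model q W}
    (hf : f ∈ modelPart q W i) (g : Model q W) :
    modelPartial W a (f * g) =
      modelPartial W a f * g + koszul (coordParity a) i • (f * modelPartial W a g) := by
  rcases a with a | α
  · rw [show coordParity (Sum.inl a : CoordIndex p q) = 0 from rfl, koszul_zero_left, one_smul]
    clear hf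
    simp only [modelPartial]
    induction f using TensorProduct.induction_on with
    | zero => simp
    | add f f' hf hf' => simp only [add_mul, map_add, hf, hf']; abel
    | tmul u w =>
      induction g using TensorProduct.induction_on with
      | zero => simp
      | add f f' hf hf' => simp only [mul_add, map_add, hf, hf']; abel
      | tmul v w' =>
        simp only [Algebra.TensorProduct.tmul_mul_tmul, LinearMap.rTensor_tmul, smoothPartial_mul,
          TensorProduct.add_tmul]
  · rw [show coordParity (Sum.inr α : CoordIndex p q) = 1 from rfl, ← smul_mul_assoc,
      ← modelInvolute_of_mem hf]
    clear hf
    simp only [modelPartial]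
    induction f using TensorProduct.induction_on with
    | zero => simp
    | add f f' hf hf' => simp only [add_mul, map_add, hf, hf']; abel
    | tmul u w =>
      induction g using TensorProduct.induction_on with
      | zero => simp
      | add f f' hf hf' => simp only [mul_add, map_add, hf, hf']; abel
      | tmul v w' =>
        simp only [Algebra.TensorProduct.tmul_mul_tmul, LinearMap.lTensor_tmul, contractLeft_mul,
          TensorProduct.tmul_add, modelInvolute_tmul]

theorem modelPartial_coord (a b : CoordIndex p q) :
    modelPartial W a (modelCoord W b) = if a = b then 1 else 0 := by
  rcases a with a | α <;> rcases b with b | β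
  · simp only [modelPartial, modelCoord, LinearMap.rTensor_tmul, smoothPartial_coord,
      Sum.inl.injEq]
    split_ifs
    · rfl
    · exact TensorProduct.zero_tmul _ _
  · have h : smoothPartial W a 1 = 0 := by
      have := smoothPartial_mul a (1 : smoothFunctions W) 1
      rwa [mul_one, one_mul, mul_one, left_eq_add] at this
    simp [modelPartial, modelCoord, h]
  · simp only [modelPartial, modelCoord, LinearMap.lTensor_tmul, CliffordAlgebra.contractLeft_one,
      TensorProduct.tmul_zero, reduceCtorEq, if_false]
  · simp only [modelPartial, modelCoord, LinearMap.lTensor_tmul, Sum.inr.injEq]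
    rw [ExteriorAlgebra.ι, CliffordAlgebra.contractLeft_ι]
    by_cases h : α = β
    · subst h
      simp [Algebra.TensorProduct.one_def]
    · simp [h]

theorem modelRes_tmul (h : W' ≤ W) (u : smoothFunctions W) (w : Grassmann q) :
    modelRes q h (u ⊗ₜ w) = smoothRes h u ⊗ₜ w := rfl

theorem modelRes_modelRes {W'' : Opens (Body p)} (h' : W'' ≤ W') (h : W' ≤ W) (f : Model q W) :
    modelRes q h' (modelRes q h f) = modelRes q (h'.trans h) f := by
  induction f using TensorProduct.induction_on with
  | zero => simp
  | add f f' hf hf' => simp only [map_add, hf, hf']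
  | tmul u w => rfl

theorem modelPartial_res (h : W' ≤ W) (a : CoordIndex p q) (f : Model q W) :
    modelPartial W' a (modelRes q h f) = modelRes q h (modelPartial W a f) := by
  induction f using TensorProduct.induction_on with
  | zero => simp
  | add f f' hf hf' => simp only [map_add, hf, hf']
  | tmul u w =>
    rcases a with a | α
    · simp only [modelPartial, modelRes_tmul, LinearMap.rTensor_tmul, smoothPartial_res]
    · simp only [modelPartial, modelRes_tmul, LinearMap.lTensor_tmul]

theorem modelRes_coord (h : W' ≤ W) (a : CoordIndex p q) :
    modelRes q h (modelCoord W a) = modelCoord W' a := by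
  rcases a with a | α
  · rfl
  · exact congrArg (· ⊗ₜ[ℝ] _) (map_one (smoothRes h))

theorem modelFiber_res (h : W' ≤ W) (y : W') (f : Model q W) :
    modelFiber q y (modelRes q h f) = modelFiber q ⟨y, h y.2⟩ f := by
  induction f using TensorProduct.induction_on with
  | zero => simp
  | add f f' hf hf' => simp only [map_add, hf, hf']
  | tmul u w => rw [modelRes_tmul, modelFiber_tmul, modelFiber_tmul]; rfl

theorem modelEval_res (h : W' ≤ W) (y : W') (f : Model q W) :
    modelEval q y (modelRes q h f) = modelEval q ⟨y, h y.2⟩ f :=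
  congrArg _ (modelFiber_res h y f)

theorem modelEval_coord_inr (y : W) (α : Fin q) :
    modelEval q y (modelCoord W (Sum.inr α : CoordIndex p q)) = 0 := by
  rw [modelCoord, modelEval_tmul]
  simp [ExteriorAlgebra.algebraMapInv]

theorem modelEval_coord_inl (y : W) (a : Fin p) :
    modelEval q y (modelCoord W (Sum.inl a : CoordIndex p q)) = (y : Body p) a := by
  rw [modelCoord, modelEval_tmul, map_one, mul_one]
  rfl

end Partial

/-! ### Hadamard's lemma -/

section Hadamard

/-- The derivative of a parametric integral is again one, of a function with values in a space of
linear maps; hence the target has to vary in the induction over the order of smoothness. -/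
theorem contDiff_parametric_integral {E F : Type u} [NormedAddCommGroup E] [NormedSpace ℝ E]
    [ProperSpace E] [NormedAddCommGroup F] [NormedSpace ℝ F] {G : E × ℝ → F}
    (hG : ContDiff ℝ ∞ G) : ContDiff ℝ ∞ fun x => ∫ t in (0 : ℝ)..1, G (x, t) := by
  rw [contDiff_infty]
  intro n
  induction n generalizing F with
  | zero =>
    rw [Nat.cast_zero, contDiff_zero]
    exact intervalIntegral.continuous_parametric_intervalIntegral_of_continuous'
      (f := fun x t => G (x, t)) hG.continuous 0 1
  | succ n ih =>
    push_cast
    rw [contDiff_succ_iff_hasFDerivAt]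
    have hG' : ContDiff ℝ ∞ fun z : E × ℝ =>
        (fderiv ℝ G z).comp (ContinuousLinearMap.inl ℝ E ℝ) :=
      (hG.fderiv_right (by simp)).clm_comp contDiff_const
    refine ⟨_, ih hG', fun x => ?_⟩
    obtain ⟨C, hC⟩ := ((isCompact_closedBall x 1).prod (isCompact_Icc (a := (0 : ℝ)) (b := 1))
      ).exists_bound_of_continuousOn hG'.continuous.continuousOn
    refine intervalIntegral.hasFDerivAt_integral_of_dominated_of_fderiv_le
      (F := fun x t => G (x, t))
      (F' := fun x t => (fderiv ℝ G (x, t)).comp (ContinuousLinearMap.inl ℝ E ℝ))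
      (bound := fun _ => C) (Metric.ball_mem_nhds x one_pos)
      (Filter.Eventually.of_forall fun y => ?_) ?_ ?_ ?_ (by simp) ?_
    · exact (hG.continuous.comp (by fun_prop : Continuous fun t : ℝ => (y, t))).aestronglyMeasurable
    · exact (hG.continuous.comp
        (by fun_prop : Continuous fun t : ℝ => (x, t))).intervalIntegrable _ _
    · exact (hG'.continuous.comp
        (by fun_prop : Continuous fun t : ℝ => (x, t))).aestronglyMeasurable
    · refine Filter.Eventually.of_forall fun t ht y hy =>
        hC (y, t) ⟨Metric.ball_subset_closedBall hy, ?_⟩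
      rw [Set.uIoc_of_le zero_le_one] at ht
      exact ⟨ht.1.le, ht.2⟩
    · refine Filter.Eventually.of_forall fun t _ y _ => ?_
      have h1 := (hG.differentiable (by simp) (y, t)).hasFDerivAt
      exact h1.comp y (hasFDerivAt_prodMk_left y t)

/-- Hadamard's lemma on `ℝ^p`, with `h_a(x) = ∫₀¹ ∂_a f(y + t (x - y)) dt`. -/
theorem exists_eq_add_sum_mul {p : ℕ} {f : Body p → ℝ} (hf : ContDiff ℝ ∞ f) (y : Body p) :
    ∃ h : Fin p → Body p → ℝ, (∀ a, ContDiff ℝ ∞ (h a)) ∧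
      ∀ x, f x = f y + ∑ a, (x a - y a) * h a x := by
  have hG : ∀ a, ContDiff ℝ ∞ fun z : Body p × ℝ =>
      fderiv ℝ f (y + z.2 • (z.1 - y)) (EuclideanSpace.single a 1) := fun a =>
    ((hf.fderiv_right (m := ∞) (by simp)).comp (by fun_prop)).clm_apply contDiff_const
  refine ⟨fun a x => ∫ t in (0 : ℝ)..1, fderiv ℝ f (y + t • (x - y)) (EuclideanSpace.single a 1),
    fun a => contDiff_parametric_integral (hG a), fun x => ?_⟩
  have hd : ∀ t : ℝ, HasDerivAt (fun t : ℝ => f (y + t • (x - y)))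
      (fderiv ℝ f (y + t • (x - y)) (x - y)) t := fun t => by
    have h1 := (hf.differentiable (by simp) (y + t • (x - y))).hasFDerivAt
    have h2 : HasDerivAt (fun t : ℝ => y + t • (x - y)) (x - y) t := by
      simpa using ((hasDerivAt_id t).smul_const (x - y)).const_add y
    exact h1.comp_hasDerivAt t h2
  have hsum : ∀ z, fderiv ℝ f z (x - y) =
      ∑ a, (x a - y a) * fderiv ℝ f z (EuclideanSpace.single a 1) := fun z => by
    have hx : x - y = ∑ a, (x a - y a) • EuclideanSpace.single a (1 : ℝ) := by
      ext b
      simp [Finset.sum_apply, Pi.single_apply]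
    conv_lhs => rw [hx]
    simp
  have hcont : ∀ a, Continuous fun t : ℝ =>
      (x a - y a) * fderiv ℝ f (y + t • (x - y)) (EuclideanSpace.single a 1) := fun a =>
    continuous_const.mul ((hG a).continuous.comp (by fun_prop : Continuous fun t : ℝ => (x, t)))
  have hint := intervalIntegral.integral_eq_sub_of_hasDerivAt (a := 0) (b := 1)
    (fun t _ => hd t) (by
      simp only [hsum]
      exact (continuous_finsetSum _ fun a _ => hcont a).intervalIntegrable _ _)
  simp only [hsum] at hint
  rw [intervalIntegral.integral_finsetSum fun a _ => (hcont a).intervalIntegrable _ _] at hint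
  simp only [intervalIntegral.integral_const_mul, one_smul, zero_smul, add_zero,
    add_sub_cancel] at hint
  linarith

variable {p q : ℕ} {W : Opens (Body p)}

/-- The restriction to `W` of a smooth function on `ℝ^p`. -/
def smoothOfContDiff (W : Opens (Body p)) (f : Body p → ℝ) (hf : ContDiff ℝ ∞ f) :
    smoothFunctions W :=
  ⟨fun x => f x, contDiffOn_zeroExtend hf.contDiffOn subset_rfl fun _ _ => rfl⟩

/-- Near `y` a smooth function on `W` extends to `ℝ^p`: multiply it by a bump function. -/
theorem exists_contDiff_eq (u : smoothFunctions W) (y : W) :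
    ∃ (W' : Opens (Body p)) (h : W' ≤ W) (f : Body p → ℝ) (hf : ContDiff ℝ ∞ f),
      (y : Body p) ∈ W' ∧ smoothRes h u = smoothOfContDiff W' f hf := by
  obtain ⟨ε, hε, hball⟩ := Metric.isOpen_iff.mp W.isOpen y y.2
  let b : ContDiffBump (y : Body p) := ⟨ε / 4, ε / 2, by positivity, by linarith⟩
  have hb : tsupport b ⊆ W := by
    rw [b.tsupport_eq]
    exact (Metric.closedBall_subset_ball (by simp only [b]; linarith)).trans hball
  refine ⟨⟨Metric.ball y (ε / 4), Metric.isOpen_ball⟩,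
    (Metric.ball_subset_ball (by linarith)).trans hball, fun x => b x * zeroExtend u.1 x, ?_,
    Metric.mem_ball_self (by positivity), ?_⟩
  · rw [contDiff_iff_contDiffAt]
    intro x
    by_cases hx : x ∈ W
    · exact b.contDiff.contDiffAt.mul (u.2.contDiffAt (W.isOpen.mem_nhds hx))
    · refine (contDiffAt_const (c := (0 : ℝ))).congr_of_eventuallyEq ?_
      filter_upwards [(isClosed_tsupport b).isOpen_compl.mem_nhds fun h => hx (hb h)] with z hz
      rw [image_eq_zero_of_notMem_tsupport hz, zero_mul]
  · ext x
    change u.1 _ = b x * zeroExtend u.1 x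
    have hb1 : b x = 1 := b.one_of_mem_closedBall (Metric.ball_subset_closedBall x.2)
    rw [hb1]
    exact (zeroExtend_apply u.1 ⟨x, _⟩).symm.trans (one_mul _).symm

theorem exists_smoothRes_eq (u : smoothFunctions W) (y : W) :
    ∃ (W' : Opens (Body p)) (h : W' ≤ W) (v : Fin p → smoothFunctions W'),
      (y : Body p) ∈ W' ∧ smoothRes h u = algebraMap ℝ _ (u.1 y) +
        ∑ a, (smoothCoord W' a - algebraMap ℝ _ ((y : Body p) a)) * v a := by
  obtain ⟨W', h, f, hf, hy, hu⟩ := exists_contDiff_eq u y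
  obtain ⟨H, hH, hfH⟩ := exists_eq_add_sum_mul hf y
  refine ⟨W', h, fun a => smoothOfContDiff W' (H a) (hH a), hy, ?_⟩
  have huy : u.1 y = f y := congrFun (congrArg Subtype.val hu) ⟨y, hy⟩
  rw [hu, huy]
  ext x
  refine (hfH x).trans ?_
  rw [AddMemClass.coe_add, AddSubmonoidClass.coe_finsetSum, Pi.add_apply, Finset.sum_apply]
  rfl

theorem exists_grassmann_eq (w : Grassmann q) : ∃ v : Fin q → Grassmann q,
    w = algebraMap ℝ _ (ExteriorAlgebra.algebraMapInv w) +
      ∑ α, ExteriorAlgebra.ι ℝ (Pi.single α 1) * v α := by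
  induction w using CliffordAlgebra.left_induction with
  | algebraMap r =>
    refine ⟨0, ?_⟩
    rw [show ExteriorAlgebra.algebraMapInv (algebraMap ℝ (Grassmann q) r) = r from
      ExteriorAlgebra.algebraMap_leftInverse _ r]
    simp
  | add w w' hw hw' =>
    obtain ⟨v, hv⟩ := hw
    obtain ⟨v', hv'⟩ := hw'
    refine ⟨v + v', ?_⟩
    conv_lhs => rw [hv, hv']
    simp only [map_add, Pi.add_apply, mul_add, Finset.sum_add_distrib]
    abel
  | ι_mul w x _ =>
    refine ⟨fun α => x α • w, ?_⟩
    have hx : x = ∑ α, x α • Pi.single α (1 : ℝ) := by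
      simpa using (pi_eq_sum_univ' x)
    have h0 : ExteriorAlgebra.algebraMapInv (ExteriorAlgebra.ι ℝ x * w) = 0 := by
      simp [ExteriorAlgebra.algebraMapInv]
    change ExteriorAlgebra.ι ℝ x * w = _ + _
    rw [show ExteriorAlgebra.algebraMapInv (CliffordAlgebra.ι 0 x * w) = 0 from h0, map_zero,
      zero_add]
    conv_lhs => rw [hx]
    simp [Finset.sum_mul]

/-- Hadamard's lemma on a superdomain: near `y`, a function differs from its value at `y` by an
element of the ideal generated by the coordinates centred at `y`. -/
theorem exists_modelRes_eq (f : Model q W) (y : W) :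
    ∃ (W' : Opens (Body p)) (h : W' ≤ W) (v : CoordIndex p q → Model q W'),
      (y : Body p) ∈ W' ∧ modelRes q h f = algebraMap ℝ _ (modelEval q y f) +
        ∑ a, (modelCoord W' a - algebraMap ℝ _ (modelEval q y (modelCoord W a))) * v a := by
  induction f using TensorProduct.induction_on with
  | zero => exact ⟨W, le_rfl, 0, y.2, by simp⟩
  | add f g hf hg =>
    obtain ⟨W₁, h₁, v₁, hy₁, e₁⟩ := hf
    obtain ⟨W₂, h₂, v₂, hy₂, e₂⟩ := hg
    refine ⟨W₁ ⊓ W₂, inf_le_left.trans h₁,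
      fun a => modelRes q inf_le_left (v₁ a) + modelRes q inf_le_right (v₂ a), ⟨hy₁, hy₂⟩, ?_⟩
    rw [map_add, ← modelRes_modelRes inf_le_left h₁, e₁]
    rw [show modelRes q (inf_le_left.trans h₁ : W₁ ⊓ W₂ ≤ W) g = _ from
      (modelRes_modelRes inf_le_right h₂ g).symm, e₂]
    simp only [map_add, map_sum, map_mul, map_sub, modelRes_coord, AlgHom.commutes, mul_add,
      Finset.sum_add_distrib]
    abel
  | tmul u w =>
    obtain ⟨W', h, v, hy, e⟩ := exists_smoothRes_eq u y
    obtain ⟨v', e'⟩ := exists_grassmann_eq w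
    refine ⟨W', h, Sum.elim (fun a => v a ⊗ₜ w) (fun α => algebraMap ℝ _ (u.1 y) ⊗ₜ v' α), hy, ?_⟩
    have key : ∀ r : ℝ, (algebraMap ℝ (smoothFunctions W') r) ⊗ₜ[ℝ] w =
        algebraMap ℝ (Model q W') (r * ExteriorAlgebra.algebraMapInv w) +
        ∑ α, (1 ⊗ₜ ExteriorAlgebra.ι ℝ (Pi.single α 1)) * (algebraMap ℝ _ r ⊗ₜ v' α) := by
      intro r
      conv_lhs => rw [e']
      rw [TensorProduct.tmul_add, TensorProduct.tmul_sum]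
      congr 1
      · rw [← mul_one (algebraMap ℝ (Grassmann q) _), ← Algebra.smul_def, TensorProduct.tmul_smul,
          Algebra.algebraMap_eq_smul_one, TensorProduct.smul_tmul', smul_smul, mul_comm,
          Algebra.algebraMap_eq_smul_one, Algebra.TensorProduct.one_def,
          TensorProduct.smul_tmul']
      · simp only [Algebra.TensorProduct.tmul_mul_tmul, one_mul]
    rw [modelRes_tmul, e, TensorProduct.add_tmul, TensorProduct.sum_tmul, modelEval_tmul, key,
      Fintype.sum_sum_type]
    simp only [modelEval_coord_inl, modelEval_coord_inr, map_zero, sub_zero, Sum.elim_inl,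
      Sum.elim_inr]
    rw [add_assoc, add_comm (∑ α, _ * _)]
    congr 2
    refine Finset.sum_congr rfl fun a _ => ?_
    rw [modelCoord, Algebra.TensorProduct.algebraMap_apply, ← TensorProduct.sub_tmul,
      Algebra.TensorProduct.tmul_mul_tmul, one_mul]

end Hadamard

/-! ### Sections of the structure sheaf -/

namespace SuperSpace

variable {S : SuperSpace.{u}}

theorem res_res {U V W : Opens S.body} (h : W ≤ V) (h' : V ≤ U) (f : S.Sec U) :
    S.res h (S.res h' f) = S.res (h.trans h') f := by
  have := congrArg AlgCat.Hom.hom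
    (S.sheaf.presheaf.map_comp (homOfLE h').op (homOfLE h).op)
  exact (DFunLike.congr_fun this f).symm

theorem res_self {U : Opens S.body} (f : S.Sec U) : S.res le_rfl f = f := by
  have := congrArg AlgCat.Hom.hom (S.sheaf.presheaf.map_id (op U))
  exact DFunLike.congr_fun this f

theorem eq_of_locally_eq {U : Opens S.body} {f g : S.Sec U}
    (h : ∀ x ∈ U, ∃ (V : Opens S.body) (hV : V ≤ U), x ∈ V ∧ S.res hV f = S.res hV g) : f = g := by
  choose V hV hx hfg using h
  refine S.sheaf.eq_of_locally_eq' (fun x : U => V x x.2) U (fun x => homOfLE (hV x x.2))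
    (fun x hxU => ?_) f g fun x => hfg x x.2
  exact Opens.mem_iSup.mpr ⟨⟨x, hxU⟩, hx x hxU⟩

theorem exists_glue {U : Opens S.body} {ι : Type u} (V : ι → Opens S.body) (hV : ∀ i, V i ≤ U)
    (hcover : ∀ x ∈ U, ∃ i, x ∈ V i) (s : ∀ i, S.Sec (V i))
    (hs : ∀ i j, S.res (inf_le_left : V i ⊓ V j ≤ V i) (s i) =
      S.res (inf_le_right : V i ⊓ V j ≤ V j) (s j)) :
    ∃ f : S.Sec U, ∀ i, S.res (hV i) f = s i := by
  obtain ⟨f, hf, -⟩ := S.sheaf.existsUnique_gluing' V U (fun i => homOfLE (hV i))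
    (fun x hx => Opens.mem_iSup.mpr (hcover x hx)) s fun i j => hs i j
  exact ⟨f, hf⟩

theorem exists_even_add_odd {U : Opens S.body} (f : S.Sec U) :
    ∃ f₀ ∈ S.part U 0, ∃ f₁ ∈ S.part U 1, f = f₀ + f₁ := by
  let _ := S.graded U
  induction f using DirectSum.Decomposition.inductionOn (S.part U) with
  | zero => exact ⟨0, zero_mem _, 0, zero_mem _, by simp⟩
  | @homogeneous i m =>
    obtain rfl | rfl : i = 0 ∨ i = 1 := by clear m; revert i; decide
    · exact ⟨m, m.2, 0, zero_mem _, by simp⟩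
    · exact ⟨0, zero_mem _, m, m.2, by simp⟩
  | add f g hf hg =>
    obtain ⟨f₀, h₀, f₁, h₁, rfl⟩ := hf
    obtain ⟨g₀, k₀, g₁, k₁, rfl⟩ := hg
    exact ⟨f₀ + g₀, add_mem h₀ k₀, f₁ + g₁, add_mem h₁ k₁, by abel⟩

theorem one_mem_part (U : Opens S.body) : (1 : S.Sec U) ∈ S.part U 0 :=
  let _ := S.graded U
  SetLike.one_mem_graded (S.part U)

theorem algebraMap_mem_part (U : Opens S.body) (r : ℝ) :
    algebraMap ℝ (S.Sec U) r ∈ S.part U 0 := by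
  rw [Algebra.algebraMap_eq_smul_one]
  exact Submodule.smul_mem _ _ (one_mem_part U)

theorem mul_mem_part {U : Opens S.body} {i j : ZMod 2} {f g : S.Sec U} (hf : f ∈ S.part U i)
    (hg : g ∈ S.part U j) : f * g ∈ S.part U (i + j) :=
  let _ := S.graded U
  SetLike.mul_mem_graded hf hg

theorem eq_zero_of_mem_part {U : Opens S.body} {f : S.Sec U} (h₀ : f ∈ S.part U 0)
    (h₁ : f ∈ S.part U 1) : f = 0 := by
  let _ := S.graded U
  have h := DirectSum.decompose_of_mem_ne (S.part U) h₀ (j := 1) (by decide)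
  rwa [DirectSum.decompose_of_mem_same (S.part U) h₁] at h

theorem mul_comm_of_mem_even {U : Opens S.body} {f : S.Sec U} (hf : f ∈ S.part U 0)
    (g : S.Sec U) : f * g = g * f := by
  obtain ⟨g₀, h₀, g₁, h₁, rfl⟩ := exists_even_add_odd g
  rw [mul_add, add_mul, S.supercomm U 0 0 f hf g₀ h₀, S.supercomm U 0 1 f hf g₁ h₁,
    koszul_zero_left, koszul_zero_left, one_smul, one_smul]

/-- Odd sections have square zero, so a real character kills them. -/
theorem map_eq_zero_of_mem_odd {U : Opens S.body} (χ : S.Sec U →ₐ[ℝ] ℝ) {f : S.Sec U}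
    (hf : f ∈ S.part U 1) : χ f = 0 := by
  have h := congrArg χ (S.supercomm U 1 1 f hf f hf)
  rw [koszul_one_one, neg_one_smul, map_neg, map_mul] at h
  exact mul_self_eq_zero.mp (self_eq_neg.mp h)

/-! ### Charts and values -/

namespace Chart

variable {p q : ℕ} (c : S.Chart p q)

/-- The image in `ℝ^p` of an open subset of the domain of the chart. -/
def image (V : Opens S.body) (h : V ≤ c.dom) : Opens (Body p) :=
  ⟨c.φ '' V, c.φ.isOpen_image_of_subset_source V.isOpen (fun _ hx => c.source_eq ▸ h hx)⟩

/-- The identification of the sections over an open subset of the domain of the chart with the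
functions on a superdomain. -/
def toModel (V : Opens S.body) (h : V ≤ c.dom) : S.Sec V ≃ₐ[ℝ] Model q (c.image V h) :=
  c.iso V h

/-- The part of `V` that the chart maps into `W`. -/
def preimage (V : Opens S.body) (h : V ≤ c.dom) (W : Opens (Body p)) : Opens S.body :=
  ⟨V ∩ c.φ ⁻¹' W, by
    have : (V : Set S.body) ∩ c.φ ⁻¹' W = (V : Set S.body) ∩ (c.φ.source ∩ c.φ ⁻¹' W) := by
      rw [← Set.inter_assoc, c.source_eq,
        Set.inter_eq_left.mpr (show (V : Set S.body) ⊆ c.dom from h)]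
    rw [this]
    exact V.isOpen.inter (c.φ.isOpen_inter_preimage W.isOpen)⟩

variable {c}

theorem preimage_le {V : Opens S.body} {h : V ≤ c.dom} {W : Opens (Body p)} :
    c.preimage V h W ≤ V := Set.inter_subset_left

theorem image_preimage_le {V : Opens S.body} {h : V ≤ c.dom} {W : Opens (Body p)} :
    c.image (c.preimage V h W) (preimage_le.trans h) ≤ W := by
  rintro _ ⟨x, hx, rfl⟩
  exact hx.2

theorem image_mono {V' V : Opens S.body} (hV : V' ≤ V) (h : V ≤ c.dom) :
    c.image V' (hV.trans h) ≤ c.image V h := Set.image_mono hV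

theorem toModel_res {V' V : Opens S.body} (hV : V' ≤ V) (h : V ≤ c.dom) (f : S.Sec V) :
    c.toModel V' (hV.trans h) (S.res hV f) = modelRes q (image_mono hV h) (c.toModel V h f) :=
  c.iso_res V' V hV h f

/-- The image of the point `x` under the chart. -/
def point {V : Opens S.body} (h : V ≤ c.dom) {x : S.body} (hx : x ∈ V) : c.image V h :=
  ⟨c.φ x, x, hx, rfl⟩

/-- The value of a section at `x`, computed in the chart. -/
def eval {V : Opens S.body} (h : V ≤ c.dom) {x : S.body} (hx : x ∈ V) : S.Sec V →ₐ[ℝ] ℝ :=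
  (modelEval q (point h hx)).comp (c.toModel V h).toAlgHom

theorem eval_apply {V : Opens S.body} (h : V ≤ c.dom) {x : S.body} (hx : x ∈ V) (f : S.Sec V) :
    eval h hx f = modelEval q (point h hx) (c.toModel V h f) := rfl

theorem eval_res {V' V : Opens S.body} (hV : V' ≤ V) (h : V ≤ c.dom) {x : S.body} (hx : x ∈ V')
    (f : S.Sec V) : eval (hV.trans h) hx (S.res hV f) = eval h (hV hx) f := by
  rw [eval_apply, toModel_res hV h, modelEval_res]
  rfl

/-- A section with non-zero value at `x` is invertible near `x`. -/
theorem exists_isUnit_res {V : Opens S.body} (h : V ≤ c.dom) {x : S.body} (hx : x ∈ V)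
    {f : S.Sec V} (hf : eval h hx f ≠ 0) :
    ∃ (V' : Opens S.body) (hV : V' ≤ V), x ∈ V' ∧ IsUnit (S.res hV f) := by
  let b := zeroExtend (modelBody (c.toModel V h f)).1
  let W : Opens (Body p) := ⟨c.image V h ∩ b ⁻¹' {0}ᶜ,
    (modelBody (c.toModel V h f)).2.continuousOn.isOpen_inter_preimage (c.image V h).isOpen
      isOpen_compl_singleton⟩
  have hb : ∀ y : c.image V h, b y = modelEval q y (c.toModel V h f) := fun y =>
    (zeroExtend_apply _ y).trans (modelBody_apply _ y)
  refine ⟨c.preimage V h W, preimage_le, ⟨hx, ⟨x, hx, rfl⟩, ?_⟩, ?_⟩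
  · change b (point h hx : c.image V h) ≠ 0
    rw [hb]
    exact hf
  · refine (MulEquiv.isUnit_map (c.toModel _ (preimage_le.trans h))).mp ?_
    rw [toModel_res preimage_le h]
    refine isUnit_of_modelEval_ne_zero fun y => ?_
    rw [modelEval_res, ← hb]
    exact (image_preimage_le y.2).2

/-- The value at `x` does not depend on the chart: it is the number `r` such that `f - r` is not
invertible in any neighbourhood of `x`. -/
theorem eval_eq_eval {c c' : S.Chart p q} {V : Opens S.body} (h : V ≤ c.dom) (h' : V ≤ c'.dom)
    {x : S.body} (hx : x ∈ V) (f : S.Sec V) : eval h hx f = eval h' hx f := by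
  by_contra hne
  have h0 : eval h' hx (f - algebraMap ℝ _ (eval h hx f)) ≠ 0 := by
    rw [map_sub, AlgHom.commutes, sub_ne_zero]
    exact fun e => hne e.symm
  obtain ⟨V', hV, hx', hu⟩ := exists_isUnit_res h' hx h0
  have := hu.map (eval (c := c) (hV.trans h) hx')
  rw [eval_res hV h hx', map_sub, AlgHom.commutes] at this
  simp at this

end Chart

end SuperSpace

open SuperSpace

namespace Supermanifold

variable {p q : ℕ} (M : Supermanifold.{u} p q)

/-- A chart around the point `x`. -/
def chartAt (x : M.body) : M.Chart p q := (M.exists_chart x).choose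

theorem mem_chartAt_dom (x : M.body) : x ∈ (M.chartAt x).dom := (M.exists_chart x).choose_spec

/-- The value of a section at a point, a real number. It does not depend on the chart in which
it is computed, see `Supermanifold.eval_eq`. -/
def eval {U : Opens M.body} {x : M.body} (hx : x ∈ U) : M.Sec U →ₐ[ℝ] ℝ :=
  (Chart.eval (V := U ⊓ (M.chartAt x).dom) inf_le_right
    ⟨hx, M.mem_chartAt_dom x⟩).comp (M.res inf_le_left)

variable {M}

theorem eval_eq {c : M.Chart p q} {V : Opens M.body} (h : V ≤ c.dom) {x : M.body} (hx : x ∈ V)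
    (f : M.Sec V) : M.eval hx f = Chart.eval h hx f := by
  have h1 := Chart.eval_res (inf_le_left : V ⊓ (M.chartAt x).dom ≤ V) h
    ⟨hx, M.mem_chartAt_dom x⟩ f
  rw [← h1]
  exact Chart.eval_eq_eval (c := M.chartAt x) (c' := c)
    (V := V ⊓ (M.chartAt x).dom) inf_le_right (inf_le_left.trans h) ⟨hx, M.mem_chartAt_dom x⟩
    (M.res inf_le_left f)

theorem eval_res {V U : Opens M.body} (h : V ≤ U) {x : M.body} (hx : x ∈ V) (f : M.Sec U) :
    M.eval hx (M.res h f) = M.eval (h hx) f := by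
  have h1 := Chart.eval_res (c := M.chartAt x) (V := U ⊓ (M.chartAt x).dom)
    (V' := V ⊓ (M.chartAt x).dom) (inf_le_inf_right _ h) inf_le_right
    ⟨hx, M.mem_chartAt_dom x⟩ (M.res inf_le_left f)
  rw [res_res] at h1
  rw [eval, AlgHom.comp_apply, res_res]
  exact h1

/-! ### Vanishing to a given order -/

variable (M) in
/-- The ideal of the sections that vanish at `x` to order `N`: near `x` they lie in the `N`-th
power of the ideal of the sections with value zero at `x`. -/
def vanishingIdeal {U : Opens M.body} {x : M.body} (hx : x ∈ U) (N : ℕ) : Ideal (M.Sec U) where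
  carrier := {f | ∃ (V : Opens M.body) (hV : V ≤ U) (hx : x ∈ V),
    M.res hV f ∈ RingHom.ker (M.eval hx) ^ N}
  add_mem' := by
    rintro f g ⟨V, hV, hx, hf⟩ ⟨V', hV', hx', hg⟩
    refine ⟨V ⊓ V', inf_le_left.trans hV, ⟨hx, hx'⟩, ?_⟩
    have h1 := map_mem_ideal_pow (M.res (inf_le_left : V ⊓ V' ≤ V)).toRingHom
      (J := RingHom.ker (M.eval (U := V ⊓ V') ⟨hx, hx'⟩))
      (fun a ha => (eval_res _ _ a).trans ha) _ hf
    have h2 := map_mem_ideal_pow (M.res (inf_le_right : V ⊓ V' ≤ V')).toRingHom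
      (J := RingHom.ker (M.eval (U := V ⊓ V') ⟨hx, hx'⟩))
      (fun a ha => (eval_res _ _ a).trans ha) _ hg
    change M.res inf_le_left (M.res hV f) ∈ _ at h1
    change M.res inf_le_right (M.res hV' g) ∈ _ at h2
    rw [res_res] at h1 h2
    rw [map_add]
    exact add_mem h1 h2
  zero_mem' := ⟨U, le_rfl, hx, by rw [map_zero]; exact zero_mem _⟩
  smul_mem' := by
    rintro a f ⟨V, hV, hx, hf⟩
    refine ⟨V, hV, hx, ?_⟩
    rw [smul_eq_mul, map_mul]
    exact Ideal.mul_mem_left _ _ hf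

instance {U : Opens M.body} {x : M.body} (hx : x ∈ U) (N : ℕ) :
    (M.vanishingIdeal hx N).IsTwoSided := by
  constructor
  rintro f a ⟨V, hV, hx, hf⟩
  refine ⟨V, hV, hx, ?_⟩
  rw [map_mul]
  exact Ideal.mul_mem_right _ _ hf

theorem res_mem_vanishingIdeal_iff {V U : Opens M.body} (h : V ≤ U) {x : M.body} (hx : x ∈ V)
    {N : ℕ} {f : M.Sec U} :
    M.res h f ∈ M.vanishingIdeal hx N ↔ f ∈ M.vanishingIdeal (h hx) N := by
  constructor
  · rintro ⟨V', hV', hx', hf⟩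
    exact ⟨V', hV'.trans h, hx', by rwa [res_res] at hf⟩
  · rintro ⟨V', hV', hx', hf⟩
    refine ⟨V' ⊓ V, inf_le_right, ⟨hx', hx⟩, ?_⟩
    have h1 := map_mem_ideal_pow (M.res (inf_le_left : V' ⊓ V ≤ V')).toRingHom
      (J := RingHom.ker (M.eval (U := V' ⊓ V) ⟨hx', hx⟩))
      (fun a ha => (eval_res _ _ a).trans ha) _ hf
    change M.res inf_le_left (M.res hV' f) ∈ _ at h1
    rwa [res_res] at h1 ⊢

theorem mem_vanishingIdeal_of_mem_pow {U : Opens M.body} {x : M.body} (hx : x ∈ U) {N : ℕ}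
    {f : M.Sec U} (hf : f ∈ RingHom.ker (M.eval hx) ^ N) : f ∈ M.vanishingIdeal hx N :=
  ⟨U, le_rfl, hx, by rwa [res_self]⟩

theorem mul_mem_vanishingIdeal {U : Opens M.body} {x : M.body} (hx : x ∈ U) {N : ℕ}
    {f g : M.Sec U} (hf : M.eval hx f = 0) (hg : g ∈ M.vanishingIdeal hx N) :
    f * g ∈ M.vanishingIdeal hx (N + 1) := by
  obtain ⟨V, hV, hx', hg⟩ := hg
  refine ⟨V, hV, hx', ?_⟩
  rw [map_mul, Ideal.IsTwoSided.pow_succ]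
  exact Ideal.mul_mem_mul ((eval_res hV hx' f).trans hf) hg

/-- A section that vanishes to order `q + 1` at all points is zero: its coefficients vanish at all
points, because the augmentation ideal of `Λ(ℝ^q)` has vanishing `(q + 1)`-st power. -/
theorem eq_zero_of_mem_vanishingIdeal {U : Opens M.body} {f : M.Sec U}
    (h : ∀ (x : M.body) (hx : x ∈ U), f ∈ M.vanishingIdeal hx (q + 1)) : f = 0 := by
  refine eq_of_locally_eq fun x₀ hx₀ => ?_
  obtain ⟨c, hc⟩ := M.exists_chart x₀
  refine ⟨U ⊓ c.dom, inf_le_left, ⟨hx₀, hc⟩, ?_⟩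
  rw [map_zero]
  apply (c.toModel _ inf_le_right).injective
  rw [map_zero]
  refine eq_zero_of_modelFiber_eq_zero ?_
  rintro ⟨_, x, hx, rfl⟩
  obtain ⟨V, hV, hxV, hf⟩ := (res_mem_vanishingIdeal_iff inf_le_left hx).mpr (h x hx.1)
  have h1 := map_mem_ideal_pow ((c.toModel V (hV.trans inf_le_right)).toAlgHom : M.Sec V →+* _)
    (J := RingHom.ker (modelEval q (Chart.point (hV.trans inf_le_right) hxV)))
    (fun a ha => (eval_eq (hV.trans inf_le_right) hxV a).symm.trans ha) _ hf
  have h2 := modelFiber_eq_zero_of_mem_pow h1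
  change modelFiber q _ (c.toModel V _ (M.res hV _)) = 0 at h2
  rw [Chart.toModel_res hV inf_le_right, modelFiber_res] at h2
  exact h2

end Supermanifold

/-! ### Partial derivatives in a chart -/

namespace SuperSpace.Chart

variable {S : SuperSpace.{u}} {p q : ℕ} {c : S.Chart p q}

/-- The inverse of the identification with a superdomain preserves parities, too. -/
theorem mem_part_of_toModel_mem {V : Opens S.body} {h : V ≤ c.dom} {i : ZMod 2} {f : S.Sec V}
    (hf : c.toModel V h f ∈ modelPart q _ i) : f ∈ S.part V i := by
  obtain ⟨f₀, h₀, f₁, h₁, rfl⟩ := exists_even_add_odd f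
  have m₀ : c.toModel V h f₀ ∈ modelPart q _ 0 := c.iso_mem V h 0 f₀ h₀
  have m₁ : c.toModel V h f₁ ∈ modelPart q _ 1 := c.iso_mem V h 1 f₁ h₁
  rw [map_add] at hf
  obtain rfl | rfl : i = 0 ∨ i = 1 := by clear hf; revert i; decide
  · have h2 := (Submodule.add_mem_iff_right _ m₀).mp hf
    have h3 := eq_zero_of_mem_modelPart h2 m₁
    rw [(map_eq_zero_iff _ (c.toModel V h).injective).mp h3, add_zero]
    exact h₀
  · have h2 := (Submodule.add_mem_iff_left _ m₁).mp hf
    have h3 := eq_zero_of_mem_modelPart m₀ h2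
    rw [(map_eq_zero_iff _ (c.toModel V h).injective).mp h3, zero_add]
    exact h₁

theorem toModel_coord (V : Opens S.body) (h : V ≤ c.dom) (a : CoordIndex p q) :
    c.toModel V h (c.coord V h a) = modelCoord _ a :=
  (c.toModel V h).apply_symm_apply _

theorem toModel_pderiv (V : Opens S.body) (h : V ≤ c.dom) (a : CoordIndex p q) (f : S.Sec V) :
    c.toModel V h (c.pderiv V h a f) = modelPartial _ a (c.toModel V h f) :=
  (c.toModel V h).apply_symm_apply _

theorem coord_mem (V : Opens S.body) (h : V ≤ c.dom) (a : CoordIndex p q) :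
    c.coord V h a ∈ S.part V (coordParity a) := by
  refine mem_part_of_toModel_mem (h := h) ?_
  rw [toModel_coord]
  exact modelCoord_mem a

theorem res_coord {V' V : Opens S.body} (hV : V' ≤ V) (h : V ≤ c.dom) (a : CoordIndex p q) :
    S.res hV (c.coord V h a) = c.coord V' (hV.trans h) a := by
  apply (c.toModel V' (hV.trans h)).injective
  rw [toModel_res hV h, toModel_coord, toModel_coord, modelRes_coord]

theorem pderiv_res {V' V : Opens S.body} (hV : V' ≤ V) (h : V ≤ c.dom) (a : CoordIndex p q)
    (f : S.Sec V) : c.pderiv V' (hV.trans h) a (S.res hV f) = S.res hV (c.pderiv V h a f) := by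
  apply (c.toModel V' (hV.trans h)).injective
  rw [toModel_res hV h, toModel_pderiv, toModel_pderiv, toModel_res hV h, modelPartial_res]

theorem pderiv_mul {V : Opens S.body} (h : V ≤ c.dom) (a : CoordIndex p q) {i : ZMod 2}
    {f : S.Sec V} (hf : f ∈ S.part V i) (g : S.Sec V) :
    c.pderiv V h a (f * g) =
      c.pderiv V h a f * g + koszul (coordParity a) i • (f * c.pderiv V h a g) := by
  apply (c.toModel V h).injective
  have hf' : c.toModel V h f ∈ modelPart q _ i := c.iso_mem V h i f hf
  rw [toModel_pderiv, map_mul, modelPartial_mul a hf', map_add, map_smul, map_mul, map_mul,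
    toModel_pderiv, toModel_pderiv]

theorem pderiv_coord {V : Opens S.body} (h : V ≤ c.dom) (a b : CoordIndex p q) :
    c.pderiv V h a (c.coord V h b) = if a = b then 1 else 0 := by
  apply (c.toModel V h).injective
  rw [toModel_pderiv, toModel_coord, modelPartial_coord]
  split_ifs <;> simp

theorem pderiv_algebraMap {V : Opens S.body} (h : V ≤ c.dom) (a : CoordIndex p q) (r : ℝ) :
    c.pderiv V h a (algebraMap ℝ _ r) = 0 := by
  have h1 := pderiv_mul h a (one_mem_part V) 1
  rw [mul_one, one_mul, mul_one, koszul_zero_right, one_smul, left_eq_add] at h1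
  rw [Algebra.algebraMap_eq_smul_one, map_smul, h1, smul_zero]

/-- Hadamard's lemma: near `x`, a section differs from its value at `x` by an element of the ideal
generated by the coordinates centred at `x`. -/
theorem exists_res_eq {V : Opens S.body} (h : V ≤ c.dom) {x : S.body} (hx : x ∈ V) (f : S.Sec V) :
    ∃ (V' : Opens S.body) (hV : V' ≤ V) (hx' : x ∈ V') (v : CoordIndex p q → S.Sec V'),
      S.res hV f = algebraMap ℝ _ (eval h hx f) + ∑ a, (c.coord V' (hV.trans h) a -
        algebraMap ℝ _ (eval (hV.trans h) hx' (c.coord V' (hV.trans h) a))) * v a := by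
  obtain ⟨W, hW, v, hy, e⟩ := exists_modelRes_eq (c.toModel V h f) (point h hx)
  have hle : c.image (c.preimage V h W) (preimage_le.trans h) ≤ W := image_preimage_le
  have hx' : x ∈ c.preimage V h W := ⟨hx, hy⟩
  refine ⟨c.preimage V h W, preimage_le, hx',
    fun a => (c.toModel _ (preimage_le.trans h)).symm (modelRes q hle (v a)), ?_⟩
  apply (c.toModel _ (preimage_le.trans h)).injective
  have e' := congrArg (modelRes q hle) e
  rw [modelRes_modelRes] at e'
  rw [toModel_res preimage_le h]
  refine e'.trans ?_
  simp only [map_add, map_sum, map_mul, map_sub, AlgHom.commutes, AlgEquiv.commutes, toModel_coord,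
    AlgEquiv.apply_symm_apply, modelRes_coord]
  congr 1
  refine Finset.sum_congr rfl fun a _ => ?_
  rw [← res_coord preimage_le h a, eval_res preimage_le h hx', eval_apply, toModel_coord]

end SuperSpace.Chart

/-! ### The coordinate expression of a vector field -/

namespace VectorField

variable {p q : ℕ} {M : Supermanifold.{u} p q} {j : ZMod 2} (X : VectorField M j)

theorem app_algebraMap (U : Opens M.body) (r : ℝ) : X.app U (algebraMap ℝ _ r) = 0 := by
  have h1 := X.leibniz U 0 1 (one_mem_part U) 1
  rw [mul_one, one_mul, mul_one, koszul_zero_right, one_smul, left_eq_add] at h1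
  rw [Algebra.algebraMap_eq_smul_one, map_smul, h1, smul_zero]

/-- The difference between a vector field `X` and the vector field `∑ X(x^a) ∂_a`. -/
def defect (c : M.Chart p q) {V : Opens M.body} (h : V ≤ c.dom) (f : M.Sec V) : M.Sec V :=
  X.app V f - ∑ a, X.app V (c.coord V h a) * c.pderiv V h a f

variable {c : M.Chart p q}

theorem defect_res {V' V : Opens M.body} (hV : V' ≤ V) (h : V ≤ c.dom) (f : M.Sec V) :
    X.defect c (hV.trans h) (M.res hV f) = M.res hV (X.defect c h f) := by
  simp only [defect, map_sub, map_sum, map_mul, X.app_res hV, ← Chart.pderiv_res hV h]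
  simp only [← Chart.res_coord hV h, X.app_res hV]

theorem defect_add {V : Opens M.body} (h : V ≤ c.dom) (f g : M.Sec V) :
    X.defect c h (f + g) = X.defect c h f + X.defect c h g := by
  simp only [defect, map_add, mul_add, Finset.sum_add_distrib]
  abel

theorem defect_algebraMap {V : Opens M.body} (h : V ≤ c.dom) (r : ℝ) :
    X.defect c h (algebraMap ℝ _ r) = 0 := by
  simp [defect, app_algebraMap, Chart.pderiv_algebraMap]

theorem defect_sum {V : Opens M.body} (h : V ≤ c.dom) {ι : Type*} (s : Finset ι)
    (f : ι → M.Sec V) : X.defect c h (∑ i ∈ s, f i) = ∑ i ∈ s, X.defect c h (f i) := by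
  classical
  induction s using Finset.induction_on with
  | empty => simpa using X.defect_algebraMap h 0
  | insert i s hi ih => rw [Finset.sum_insert hi, Finset.sum_insert hi, defect_add, ih]

theorem defect_coord {V : Opens M.body} (h : V ≤ c.dom) (a : CoordIndex p q) :
    X.defect c h (c.coord V h a) = 0 := by
  simp [defect, Chart.pderiv_coord]

/-- The defect obeys the same Leibniz rule as `X`. -/
theorem defect_mul {V : Opens M.body} (h : V ≤ c.dom) {i : ZMod 2} {f : M.Sec V}
    (hf : f ∈ M.part V i) (g : M.Sec V) :
    X.defect c h (f * g) = X.defect c h f * g + koszul j i • (f * X.defect c h g) := by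
  have key : ∀ a, X.app V (c.coord V h a) * c.pderiv V h a (f * g) =
      X.app V (c.coord V h a) * c.pderiv V h a f * g +
        koszul j i • (f * (X.app V (c.coord V h a) * c.pderiv V h a g)) := by
    intro a
    -- the signs from moving `f` past `∂_a` and past `X(x^a)` combine to that of moving it past `X`
    rw [Chart.pderiv_mul h a hf, mul_add, mul_assoc, mul_smul_comm, ← mul_assoc _ f,
      M.supercomm V _ _ _ (X.app_mem V _ _ (Chart.coord_mem V h a)) f hf, smul_mul_assoc,
      smul_smul, koszul_mul_koszul, mul_assoc f]
  simp only [defect, key, X.leibniz V i f hf g, Finset.sum_add_distrib, sub_mul, Finset.sum_mul,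
    mul_sub, Finset.mul_sum, smul_sub, Finset.smul_sum]
  abel

/-- The induction over the order `N` uses that the defect of `X` kills the coordinates and that the
sections near `x` are generated, up to constants, by the coordinates centred at `x`. -/
theorem defect_mem_vanishingIdeal {V : Opens M.body} (h : V ≤ c.dom) {x : M.body} (hx : x ∈ V)
    (N : ℕ) (f : M.Sec V) : X.defect c h f ∈ M.vanishingIdeal hx N := by
  induction N generalizing V with
  | zero =>
    refine Supermanifold.mem_vanishingIdeal_of_mem_pow hx ?_
    rw [Submodule.pow_zero, Ideal.one_eq_top]
    trivial
  | succ N ih =>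
    obtain ⟨V', hV, hx', v, e⟩ := Chart.exists_res_eq h hx f
    rw [← Supermanifold.res_mem_vanishingIdeal_iff hV hx', ← X.defect_res hV h, e, defect_add,
      defect_algebraMap, zero_add, defect_sum]
    refine Ideal.sum_mem _ fun a _ => ?_
    set r := Chart.eval (hV.trans h) hx' (c.coord V' (hV.trans h) a) with hr
    have hz : c.coord V' (hV.trans h) a - algebraMap ℝ _ r ∈ M.part V' (coordParity a) := by
      have hc := Chart.coord_mem V' (hV.trans h) a
      rcases a with a | α
      · exact sub_mem hc (algebraMap_mem_part V' r)
      · rw [hr, map_eq_zero_of_mem_odd _ hc, map_zero, sub_zero]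
        exact hc
    have hz0 : X.defect c (hV.trans h) (c.coord V' (hV.trans h) a - algebraMap ℝ _ r) = 0 := by
      rw [sub_eq_add_neg, ← map_neg, defect_add, defect_coord, defect_algebraMap, add_zero]
    rw [defect_mul X _ hz, hz0, zero_mul, zero_add]
    refine Submodule.smul_of_tower_mem _ _
      (Supermanifold.mul_mem_vanishingIdeal hx' ?_ (ih _ hx' _))
    rw [Supermanifold.eval_eq (hV.trans h) hx', map_sub, AlgHom.commutes]
    exact sub_self _

/-- The coordinate expression `X = ∑ X(x^a) ∂_a`. -/
theorem app_eq_sum {V : Opens M.body} (h : V ≤ c.dom) (f : M.Sec V) :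
    X.app V f = ∑ a, X.app V (c.coord V h a) * c.pderiv V h a f :=
  sub_eq_zero.mp (Supermanifold.eq_zero_of_mem_vanishingIdeal fun _ hx =>
    X.defect_mem_vanishingIdeal h hx (q + 1) f)

/-- A vector field lowers the order of vanishing by at most one. -/
theorem app_mem_vanishingIdeal {U : Opens M.body} {x : M.body} (hx : x ∈ U) {N : ℕ} {f : M.Sec U}
    (hf : f ∈ M.vanishingIdeal hx (N + 1)) : X.app U f ∈ M.vanishingIdeal hx N := by
  obtain ⟨V, hV, hx, hf⟩ := hf
  refine ⟨V, hV, hx, ?_⟩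
  rw [← X.app_res]
  generalize M.res hV f = g at hf
  clear f
  induction N generalizing g with
  | zero => rw [Submodule.pow_zero, Ideal.one_eq_top]; trivial
  | succ N ih =>
    rw [Ideal.IsTwoSided.pow_succ] at hf
    induction hf using Submodule.mul_induction_on' with
    | mem_mul_mem b hb d hd =>
      obtain ⟨b₀, h₀, b₁, h₁, rfl⟩ := exists_even_add_odd b
      have hb₁ : b₁ ∈ RingHom.ker (M.eval hx) := map_eq_zero_of_mem_odd _ h₁
      have hb₀ : b₀ ∈ RingHom.ker (M.eval hx) := (Ideal.add_mem_iff_left _ hb₁).mp hb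
      have hbd : ∀ b' ∈ RingHom.ker (M.eval hx),
          b' * X.app V d ∈ RingHom.ker (M.eval hx) ^ (N + 1) := fun b' hb' => by
          rw [Ideal.IsTwoSided.pow_succ]
          exact Ideal.mul_mem_mul hb' (ih d hd)
      rw [add_mul, map_add, X.leibniz V 0 b₀ h₀ d, X.leibniz V 1 b₁ h₁ d]
      exact add_mem (add_mem (Ideal.mul_mem_left _ _ hd)
        (Submodule.smul_of_tower_mem _ _ (hbd b₀ hb₀)))
        (add_mem (Ideal.mul_mem_left _ _ hd) (Submodule.smul_of_tower_mem _ _ (hbd b₁ hb₁)))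
    | add b _ d _ hb hd =>
      rw [map_add]
      exact add_mem hb hd

end VectorField

/-! ### Truncated exponential series -/

/-- The exponential series up to order `N - 1`. -/
def expTrunc {A : Type*} [Ring A] [Algebra ℝ A] (N : ℕ) (a : A) : A :=
  ∑ k ∈ Finset.range N, ((k.factorial : ℝ)⁻¹) • a ^ k

theorem map_expTrunc {A B : Type*} [Ring A] [Algebra ℝ A] [Ring B] [Algebra ℝ B] (φ : A →ₐ[ℝ] B)
    (N : ℕ) (a : A) : φ (expTrunc N a) = expTrunc N (φ a) := by
  simp [expTrunc]

theorem expTrunc_zero {A : Type*} [Ring A] [Algebra ℝ A] (N : ℕ) :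
    expTrunc (N + 1) (0 : A) = 1 := by
  rw [expTrunc, Finset.sum_range_succ']
  simp

theorem hasDerivAt_expTrunc (N : ℕ) (t : ℝ) :
    HasDerivAt (fun s : ℝ => expTrunc (N + 1) s) (expTrunc N t) t := by
  induction N with
  | zero => simpa [expTrunc] using hasDerivAt_const t (1 : ℝ)
  | succ N ih =>
    have h1 := ih.add (((hasDerivAt_pow (N + 1) t).const_smul (((N + 1).factorial : ℝ)⁻¹)))
    have e1 : (fun s : ℝ => expTrunc (N + 1 + 1) s) = (fun s : ℝ => expTrunc (N + 1) s) +
        ((((N + 1).factorial : ℝ)⁻¹) • fun s : ℝ => s ^ (N + 1)) := by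
      ext s
      exact Finset.sum_range_succ _ _
    rw [e1]
    refine h1.congr_deriv ?_
    rw [expTrunc, expTrunc, Finset.sum_range_succ]
    congr 1
    rw [Nat.factorial_succ]
    push_cast
    simp only [smul_eq_mul]
    field_simp

/-- Taylor's formula for the exponential, with a smooth function in the remainder. -/
theorem exists_exp_eq (N : ℕ) : ∃ h : ℝ → ℝ, ContDiff ℝ ∞ h ∧
    ∀ t, Real.exp t = expTrunc N t + t ^ N * h t := by
  induction N with
  | zero => exact ⟨Real.exp, Real.contDiff_exp, fun t => by simp [expTrunc]⟩
  | succ N ih =>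
    obtain ⟨h, hh, e⟩ := ih
    -- the remainder of order `N + 1` is the integral of the remainder of order `N`
    have hG : ContDiff ℝ ∞ fun z : ℝ × ℝ => z.2 ^ N * h (z.2 * z.1) :=
      (contDiff_snd.pow N).mul (hh.comp (contDiff_snd.mul contDiff_fst))
    refine ⟨fun t => ∫ s in (0 : ℝ)..1, s ^ N * h (s * t), contDiff_parametric_integral hG,
      fun t => ?_⟩
    have hd : ∀ s : ℝ, HasDerivAt (fun s : ℝ => Real.exp (s * t) - expTrunc (N + 1) (s * t))
        (t ^ (N + 1) * (s ^ N * h (s * t))) s := fun s => by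
      have h1 := ((Real.hasDerivAt_exp (s * t)).sub (hasDerivAt_expTrunc N (s * t))).comp s
        ((hasDerivAt_id s).mul_const t)
      refine h1.congr_deriv ?_
      rw [e (s * t)]
      ring
    have hint := intervalIntegral.integral_eq_sub_of_hasDerivAt (a := 0) (b := 1)
      (fun s _ => hd s) ((continuous_const.mul (hG.continuous.comp
        (by fun_prop : Continuous fun s : ℝ => (t, s)))).intervalIntegrable _ _)
    rw [intervalIntegral.integral_const_mul, zero_mul, one_mul, expTrunc_zero, Real.exp_zero,
      sub_self, sub_zero] at hint
    linarith

/-- Modulo an ideal that contains the relevant `N`-th powers, the truncated exponential series turns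
sums into products. -/
theorem expTrunc_mul_sub_mem {A : Type*} [Ring A] [Algebra ℝ A] {J : Ideal A} [J.IsTwoSided]
    {N : ℕ} {a b : A} (hab : Commute a b) (ha : a ^ N ∈ J) (hb : b ^ N ∈ J)
    (hs : (a + b) ^ N ∈ J) : expTrunc N a * expTrunc N b - expTrunc N (a + b) ∈ J := by
  let _ : Module ℚ (A ⧸ J) := Module.compHom _ (algebraMap ℚ ℝ)
  have key : ∀ c : A, c ^ N ∈ J →
      Ideal.Quotient.mk J (expTrunc N c) = IsNilpotent.exp (Ideal.Quotient.mk J c) := by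
    intro c hc
    have h0 : Ideal.Quotient.mk J c ^ N = 0 := by
      rw [← map_pow]; exact Ideal.Quotient.eq_zero_iff_mem.mpr hc
    rw [IsNilpotent.exp_eq_sum h0, expTrunc, map_sum]
    refine Finset.sum_congr rfl fun k _ => ?_
    rw [← map_pow, ← Ideal.Quotient.mkₐ_eq_mk ℝ, map_smul]
    change ((k.factorial : ℝ)⁻¹) • Ideal.Quotient.mk J (c ^ k) =
      algebraMap ℚ ℝ ((k.factorial : ℚ)⁻¹) • Ideal.Quotient.mk J (c ^ k)
    simp
  have nil : ∀ c : A, c ^ N ∈ J → IsNilpotent (Ideal.Quotient.mk J c) := fun c hc =>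
    ⟨N, by rw [← map_pow]; exact Ideal.Quotient.eq_zero_iff_mem.mpr hc⟩
  rw [← Ideal.Quotient.eq_zero_iff_mem, map_sub, map_mul, key a ha, key b hb, key _ hs, map_add,
    IsNilpotent.exp_add_of_commute (hab.map _) (nil a ha) (nil b hb), sub_self]

theorem expTrunc_eq_of_pow_eq_zero {A : Type*} [Ring A] [Algebra ℝ A] {m N : ℕ} (h : m ≤ N) {a : A}
    (ha : a ^ m = 0) : expTrunc N a = expTrunc m a := by
  refine (Finset.sum_subset (Finset.range_mono h) fun k _ hk => ?_).symm
  rw [pow_eq_zero_of_le (by simpa using hk) ha, smul_zero]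

/-! ### The exponential of an even section -/

namespace Supermanifold

variable {p q : ℕ} {M : Supermanifold.{u} p q}

/-- The section `g` is the exponential of `f`: at every point `x`, with `r = f(x)`, it agrees with
`e^r ∑_{k < N} (f - r)^k / k!` to order `N`. Since sections are determined by their expansions to
order `q + 1`, it suffices to consider `N > q`. -/
def IsExp {U : Opens M.body} (f g : M.Sec U) : Prop :=
  ∀ (x : M.body) (hx : x ∈ U) (N : ℕ), q < N →
    g - Real.exp (M.eval hx f) • expTrunc N (f - algebraMap ℝ _ (M.eval hx f)) ∈
      M.vanishingIdeal hx N

theorem sub_eval_pow_mem {U : Opens M.body} {x : M.body} (hx : x ∈ U) (N : ℕ) (f : M.Sec U) :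
    (f - algebraMap ℝ _ (M.eval hx f)) ^ N ∈ M.vanishingIdeal hx N :=
  mem_vanishingIdeal_of_mem_pow hx (pow_mem_ideal_pow
    (by rw [RingHom.mem_ker, map_sub, AlgHom.commutes]; exact sub_self _) N)

theorem sub_expTrunc_mem_res_iff {V U : Opens M.body} (h : V ≤ U) {x : M.body} (hx : x ∈ V) (N : ℕ)
    (f g : M.Sec U) :
    M.res h g - Real.exp (M.eval hx (M.res h f)) •
      expTrunc N (M.res h f - algebraMap ℝ _ (M.eval hx (M.res h f))) ∈ M.vanishingIdeal hx N ↔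
    g - Real.exp (M.eval (h hx) f) • expTrunc N (f - algebraMap ℝ _ (M.eval (h hx) f)) ∈
      M.vanishingIdeal (h hx) N := by
  rw [← res_mem_vanishingIdeal_iff h hx, map_sub, map_smul, map_expTrunc, map_sub,
    AlgHom.commutes, eval_res]

namespace IsExp

variable {U : Opens M.body} {f g g' : M.Sec U}

theorem res {V : Opens M.body} (h : V ≤ U) (hg : IsExp f g) : IsExp (M.res h f) (M.res h g) :=
  fun _ hx N hN => (sub_expTrunc_mem_res_iff h hx N f g).mpr (hg _ (h hx) N hN)

theorem unique (hg : IsExp f g) (hg' : IsExp f g') : g = g' := by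
  refine sub_eq_zero.mp (eq_zero_of_mem_vanishingIdeal fun x hx => ?_)
  have := sub_mem (hg x hx (q + 1) q.lt_succ_self) (hg' x hx (q + 1) q.lt_succ_self)
  rwa [sub_sub_sub_cancel_right] at this

theorem mul_eq_one (hg : IsExp f g) (hg' : IsExp (-f) g') : g * g' = 1 := by
  refine sub_eq_zero.mp (eq_zero_of_mem_vanishingIdeal fun x hx => ?_)
  set J := M.vanishingIdeal hx (q + 1)
  have h := hg x hx (q + 1) q.lt_succ_self
  have h' := hg' x hx (q + 1) q.lt_succ_self
  set n := f - algebraMap ℝ _ (M.eval hx f) with hn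
  have hn' : -f - algebraMap ℝ _ (M.eval hx (-f)) = -n := by
    rw [hn, map_neg, map_neg]; abel
  rw [hn', map_neg, Real.exp_neg] at h'
  have hnJ : n ^ (q + 1) ∈ J := sub_eval_pow_mem hx (q + 1) f
  have h3 : expTrunc (q + 1) n * expTrunc (q + 1) (-n) - 1 ∈ J := by
    have := expTrunc_mul_sub_mem (J := J) (N := q + 1) (Commute.refl n).neg_right hnJ
      (by rw [neg_pow]; exact Ideal.mul_mem_left _ _ hnJ)
      (by rw [add_neg_cancel, zero_pow (Nat.succ_ne_zero q)]; exact zero_mem _)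
    rwa [add_neg_cancel, expTrunc_zero] at this
  set r := Real.exp (M.eval hx f) with hr
  have hr0 : r ≠ 0 := (Real.exp_pos _).ne'
  have key : g * g' - 1 = (g - r • expTrunc (q + 1) n) * g' +
      r • expTrunc (q + 1) n * (g' - r⁻¹ • expTrunc (q + 1) (-n)) +
      (expTrunc (q + 1) n * expTrunc (q + 1) (-n) - 1) := by
    rw [sub_mul, mul_sub, smul_mul_smul_comm, mul_inv_cancel₀ hr0, one_smul]
    abel
  rw [key]
  exact add_mem (add_mem (Ideal.mul_mem_right _ _ h) (Ideal.mul_mem_left _ _ h')) h3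

theorem app_expTrunc {j : ZMod 2} (X : VectorField M j) {n : M.Sec U} (hn : n ∈ M.part U 0)
    (N : ℕ) : X.app U (expTrunc (N + 1) n) = X.app U n * expTrunc N n := by
  have hpow : ∀ k : ℕ, X.app U (n ^ (k + 1)) = ((k + 1 : ℕ) : ℝ) • (X.app U n * n ^ k) := by
    intro k
    induction k with
    | zero => simp
    | succ k ih =>
      rw [pow_succ', X.leibniz U 0 n hn, ih, koszul_zero_right, one_smul, mul_smul_comm,
        ← mul_assoc, mul_comm_of_mem_even hn (X.app U n), mul_assoc, ← pow_succ']
      push_cast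
      module
  rw [expTrunc, Finset.sum_range_succ', map_add, map_sum, expTrunc, Finset.mul_sum]
  have h0 : X.app U (((Nat.factorial 0 : ℝ)⁻¹) • n ^ 0) = 0 := by
    rw [pow_zero, ← Algebra.algebraMap_eq_smul_one, X.app_algebraMap]
  rw [h0, add_zero]
  refine Finset.sum_congr rfl fun k _ => ?_
  rw [map_smul, hpow, smul_smul, mul_smul_comm, Nat.factorial_succ]
  congr 1
  push_cast
  field_simp

/-- The chain rule `X(e^f) = X(f) e^f`: term by term, the vector field maps the expansion of `e^f`
to order `N + 1` to `X(f)` times the expansion to order `N`. -/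
theorem app_eq (hg : IsExp f g) (hf : f ∈ M.part U 0) {j : ZMod 2} (X : VectorField M j) :
    X.app U g = X.app U f * g := by
  refine sub_eq_zero.mp (eq_zero_of_mem_vanishingIdeal fun x hx => ?_)
  have h1 := X.app_mem_vanishingIdeal hx (hg x hx (q + 2) (by omega))
  have h2 := hg x hx (q + 1) (by omega)
  rw [map_sub, map_smul, app_expTrunc X (sub_mem hf (algebraMap_mem_part U _)), map_sub,
    X.app_algebraMap, sub_zero, ← mul_smul_comm] at h1
  have := sub_mem h1 (Ideal.mul_mem_left _ (X.app U f) h2)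
  rwa [mul_sub, sub_sub_sub_cancel_right] at this

end IsExp

/-- In a chart the exponential of `f = u + n`, with `u` a smooth function of the even coordinates
and `n` nilpotent, is `e^u` times the finite exponential series of `n`. -/
theorem exists_isExp_of_le_dom {c : M.Chart p q} {V : Opens M.body} (h : V ≤ c.dom) {f : M.Sec V}
    (hf : f ∈ M.part V 0) : ∃ g ∈ M.part V 0, IsExp f g := by
  let ι : smoothFunctions (c.image V h) →ₐ[ℝ] M.Sec V :=
    (c.toModel V h).symm.toAlgHom.comp Algebra.TensorProduct.includeLeft
  have hι : ∀ u, ι u ∈ M.part V 0 := fun u => by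
    refine Chart.mem_part_of_toModel_mem (h := h) ?_
    rw [show c.toModel V h (ι u) = u ⊗ₜ 1 from (c.toModel V h).apply_symm_apply _]
    exact tmul_one_mem_modelPart u
  have hcomp : ∀ (φ : ℝ → ℝ) (_ : ContDiff ℝ ∞ φ) (u : smoothFunctions (c.image V h)),
      ∃ v : smoothFunctions (c.image V h), ∀ y, v.1 y = φ (u.1 y) := fun φ hφ u =>
    ⟨⟨fun y => φ (u.1 y), contDiffOn_zeroExtend (g := fun y => φ (zeroExtend u.1 y))
      (hφ.comp_contDiffOn u.2) subset_rfl fun y _ => by rw [zeroExtend_apply]⟩, fun _ => rfl⟩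
  set u := modelBody (c.toModel V h f) with hu
  obtain ⟨v, hv⟩ := hcomp Real.exp Real.contDiff_exp u
  have hn : (f - ι u) ^ (q + 1) = 0 := by
    apply (c.toModel V h).injective
    rw [map_zero, map_pow, map_sub,
      show c.toModel V h (ι u) = u ⊗ₜ 1 from (c.toModel V h).apply_symm_apply _]
    exact sub_modelBody_pow _
  have hneven : f - ι u ∈ M.part V 0 := sub_mem hf (hι u)
  generalize hn' : f - ι u = n at hn hneven
  have hT : expTrunc (q + 1) n ∈ M.part V 0 := by
    let _ := M.graded V
    refine Submodule.sum_mem _ fun k _ => Submodule.smul_mem _ _ ?_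
    simpa using SetLike.pow_mem_graded k hneven
  refine ⟨ι v * expTrunc (q + 1) n, mul_mem_part (hι v) hT, fun x hx N hN => ?_⟩
  set I := RingHom.ker (M.eval hx) with hI
  set r := M.eval hx f with hr
  have hnI : n ∈ I := by
    have := congrArg (M.eval hx) hn
    rw [map_pow, map_zero] at this
    exact pow_eq_zero_iff (Nat.succ_ne_zero q) |>.mp this
  have hfI : f - algebraMap ℝ _ r ∈ I := by
    rw [hI, RingHom.mem_ker, map_sub, AlgHom.commutes]
    exact sub_self _
  have hs : f - algebraMap ℝ _ r = (ι u - algebraMap ℝ _ r) + n := by rw [← hn']; abel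
  have hsI : ι u - algebraMap ℝ _ r ∈ I := (Ideal.add_mem_iff_left _ hnI).mp (hs ▸ hfI)
  obtain ⟨φ, hφ, e⟩ := exists_exp_eq N
  obtain ⟨w, hw⟩ := hcomp (fun t => Real.exp r * φ (t - r))
    (contDiff_const.mul (hφ.comp (contDiff_id.sub contDiff_const))) u
  -- Taylor's formula for `e^u` in powers of `u - r`
  have hvw : v = Real.exp r • expTrunc N (u - algebraMap ℝ _ r) +
      (u - algebraMap ℝ _ r) ^ N * w := by
    ext y
    have h1 := map_expTrunc (smoothEval y) N (u - algebraMap ℝ _ r)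
    rw [map_sub, AlgHom.commutes] at h1
    change v.1 y = Real.exp r * smoothEval y (expTrunc N (u - algebraMap ℝ _ r)) +
      (u.1 y - r) ^ N * w.1 y
    rw [hv, hw, h1, show Real.exp (u.1 y) = Real.exp r * Real.exp (u.1 y - r) by
      rw [← Real.exp_add]; ring_nf, e (u.1 y - r)]
    change _ = Real.exp r * expTrunc N (u.1 y - r) + _
    ring
  have hE : ι v - Real.exp r • expTrunc N (ι u - algebraMap ℝ _ r) ∈ I ^ N := by
    have : ι v - Real.exp r • expTrunc N (ι u - algebraMap ℝ _ r) =
        (ι u - algebraMap ℝ _ r) ^ N * ι w := by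
      conv_lhs => rw [hvw]
      rw [map_add, map_smul, map_expTrunc, map_mul, map_pow, map_sub, AlgHom.commutes,
        add_sub_cancel_left]
    rw [this]
    exact Ideal.mul_mem_right _ _ (pow_mem_ideal_pow hsI N)
  rw [← expTrunc_eq_of_pow_eq_zero (Nat.succ_le_of_lt hN) hn]
  refine mem_vanishingIdeal_of_mem_pow hx ?_
  have hprod := expTrunc_mul_sub_mem (J := I ^ N) (N := N)
    (mul_comm_of_mem_even (sub_mem (hι u) (algebraMap_mem_part V r)) n)
    (pow_mem_ideal_pow hsI N) (pow_mem_ideal_pow hnI N) (pow_mem_ideal_pow (hs ▸ hfI) N)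
  rw [← hs] at hprod
  have key : ι v * expTrunc N n - Real.exp r • expTrunc N (f - algebraMap ℝ _ r) =
      (ι v - Real.exp r • expTrunc N (ι u - algebraMap ℝ _ r)) * expTrunc N n +
      Real.exp r • (expTrunc N (ι u - algebraMap ℝ _ r) * expTrunc N n -
        expTrunc N (f - algebraMap ℝ _ r)) := by
    rw [sub_mul, smul_mul_assoc, smul_sub]
    abel
  rw [key]
  exact add_mem (Ideal.mul_mem_right _ _ hE) (Submodule.smul_of_tower_mem _ _ hprod)

/-- The exponentials in charts agree on overlaps, since exponentials are unique; hence they glue. -/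
theorem exists_isExp {U : Opens M.body} {f : M.Sec U} (hf : f ∈ M.part U 0) :
    ∃ g ∈ M.part U 0, IsExp f g := by
  let V : M.body → Opens M.body := fun x => U ⊓ (M.chartAt x).dom
  have hV : ∀ x, V x ≤ U := fun x => inf_le_left
  have hlocal : ∀ x, ∃ g ∈ M.part (V x) 0, IsExp (M.res (hV x) f) g := fun x =>
    exists_isExp_of_le_dom (c := M.chartAt x) inf_le_right (M.res_mem (hV x) 0 f hf)
  choose s hs hexp using hlocal
  obtain ⟨g, hg⟩ := exists_glue (S := M.toSuperSpace) V hV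
    (fun x hx => ⟨x, hx, M.mem_chartAt_dom x⟩) s fun x y => by
      have h1 := (hexp x).res (inf_le_left : V x ⊓ V y ≤ V x)
      have h2 := (hexp y).res (inf_le_right : V x ⊓ V y ≤ V y)
      rw [res_res] at h1 h2
      exact h1.unique h2
  refine ⟨g, ?_, fun x hx N hN => ?_⟩
  · obtain ⟨g₀, h₀, g₁, h₁, rfl⟩ := exists_even_add_odd g
    have : g₁ = 0 := eq_of_locally_eq fun x hx => ⟨V x, hV x, ⟨hx, M.mem_chartAt_dom x⟩, by
      have h2 := hg x
      rw [map_add] at h2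
      have h3 : M.res (hV x) g₁ = s x - M.res (hV x) g₀ := by rw [← h2, add_sub_cancel_left]
      rw [map_zero]
      exact eq_zero_of_mem_part (h3 ▸ sub_mem (hs x) (M.res_mem (hV x) 0 g₀ h₀))
        (M.res_mem (hV x) 1 g₁ h₁)⟩
    rw [this, add_zero]
    exact h₀
  · have hxV : x ∈ V x := ⟨hx, M.mem_chartAt_dom x⟩
    have h1 := hexp x x hxV N hN
    rw [← hg x] at h1
    exact (sub_expTrunc_mem_res_iff (hV x) hxV N f g).mp h1

end Supermanifold

/-! ### Rescaling a Berezin volume -/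

section Rescaling

variable {p q : ℕ} {M : Supermanifold.{u} p q}

/-- The Berezin volume `ρ g`, for a Berezin volume `ρ` and an even invertible function `g`. -/
def BerezinVolume.rescale (ρ : BerezinVolume M) (g : Functions M) (hg : g ∈ M.part ⊤ 0)
    (hu : IsUnit g) : BerezinVolume M where
  coeff c := ρ.coeff c * M.res le_top g
  even c := mul_mem_part (ρ.even c) (M.res_mem le_top 0 g hg)
  nowhere_vanishing c := (ρ.nowhere_vanishing c).mul (hu.map _)
  transform c c' := by
    rw [map_mul, map_mul, ρ.transform c c', res_res, res_res, mul_assoc]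

/-- `L_X (ρ g) = (L_X ρ) g + ρ X(g)`. -/
theorem lieDerivative_rescale {j : ZMod 2} (X : VectorField M j) (ρ : BerezinVolume M)
    (g : Functions M) (hg : g ∈ M.part ⊤ 0) (hu : IsUnit g) (c : M.Chart p q) :
    lieDerivative X (ρ.rescale g hg hu) c =
      lieDerivative X ρ c * M.res le_top g + ρ.coeff c * M.res le_top (X.app ⊤ g) := by
  have hsign : ∀ a : CoordIndex p q,
      koszul (coordParity a) (j + 1) * koszul (coordParity a) (coordParity a + j) = 1 := by
    have h : ∀ i j : ZMod 2, Even (i.val * (j + 1).val + i.val * (i + j).val) := by decide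
    intro a
    rw [koszul, koszul, ← pow_add]
    exact (h _ _).neg_one_pow
  have hterm : ∀ a : CoordIndex p q, koszul (coordParity a) (j + 1) •
      c.pderiv c.dom le_rfl a (X.app c.dom (c.coord c.dom le_rfl a) *
        (ρ.coeff c * M.res le_top g)) =
      (koszul (coordParity a) (j + 1) •
        c.pderiv c.dom le_rfl a (X.app c.dom (c.coord c.dom le_rfl a) * ρ.coeff c)) *
          M.res le_top g +
      ρ.coeff c * (X.app c.dom (c.coord c.dom le_rfl a) *
        c.pderiv c.dom le_rfl a (M.res le_top g)) := by
    intro a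
    have hmem : X.app c.dom (c.coord c.dom le_rfl a) * ρ.coeff c ∈
        M.part c.dom (coordParity a + j) := by
      simpa using mul_mem_part (X.app_mem _ _ _ (Chart.coord_mem c.dom le_rfl a)) (ρ.even c)
    rw [← mul_assoc, Chart.pderiv_mul le_rfl a hmem, smul_add, smul_smul, hsign, one_smul,
      smul_mul_assoc, ← mul_assoc (ρ.coeff c), mul_comm_of_mem_even (ρ.even c)]
  change ∑ a : CoordIndex p q, koszul (coordParity a) (j + 1) •
      c.pderiv c.dom le_rfl a (X.app c.dom (c.coord c.dom le_rfl a) *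
        (ρ.coeff c * M.res le_top g)) = _
  rw [Finset.sum_congr rfl fun a _ => hterm a, Finset.sum_add_distrib, ← Finset.sum_mul,
    ← Finset.mul_sum, ← X.app_eq_sum, X.app_res]
  rfl

theorem lieDerivative_add {j : ZMod 2} (X Y : VectorField M j) (ρ : BerezinVolume M) :
    lieDerivative (X + Y) ρ = lieDerivative X ρ + lieDerivative Y ρ := by
  funext c
  change ∑ a, _ • c.pderiv _ _ a ((X.app _ _ + Y.app _ _) * _) = _
  simp only [add_mul, map_add, smul_add, Finset.sum_add_distrib]
  rfl

theorem lieDerivative_sub {j : ZMod 2} (X Y : VectorField M j) (ρ : BerezinVolume M) :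
    lieDerivative (X - Y) ρ = lieDerivative X ρ - lieDerivative Y ρ := by
  funext c
  change ∑ a, _ • c.pderiv _ _ a ((X.app _ _ - Y.app _ _) * _) = _
  simp only [sub_mul, map_sub, smul_sub, Finset.sum_sub_distrib]
  rfl

/-- If `Div_ρ X = X(ψ)`, then `X` preserves the volume `ρ e^{-ψ}`. -/
theorem lieDerivative_rescale_eq_zero {j : ZMod 2} {X : VectorField M j} {ρ : BerezinVolume M}
    {ψ g : Functions M} (hψ : ψ ∈ M.part ⊤ 0) (hdiv : IsDivergence ρ X (X.app ⊤ ψ))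
    (hexp : Supermanifold.IsExp (-ψ) g) (hg : g ∈ M.part ⊤ 0) (hu : IsUnit g) :
    lieDerivative X (ρ.rescale g hg hu) = 0 := by
  funext c
  rw [lieDerivative_rescale, ← hdiv c, hexp.app_eq (neg_mem hψ) X, map_neg, neg_mul, map_neg,
    map_mul, mul_neg, ← mul_assoc, add_neg_cancel]
  rfl

end Rescaling

end SuperGeometry

end

theorem mainTheorem2 {p q : ℕ} (T : N2SupermanifoldWithVolume.{u} p q)
    (ρ₁ ρ₂ : BerezinVolume T.M)
    (h₁ : IsDivergence ρ₁ T.Q₁ 0) (h₂ : IsDivergence ρ₂ T.Q₂ 0)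
    (ψ : Functions T.M) (hψ : ψ ∈ T.M.part ⊤ 0)
    (hQ₂ : IsDivergence ρ₁ T.Q₂ (T.Q₂.app ⊤ ψ)) (hQ₁ : T.Q₁.app ⊤ ψ = 0) :
    ∃ ρ' : BerezinVolume T.M,
      lieDerivative (T.Q₁ + T.Q₂) ρ' = 0 ∧ lieDerivative (T.Q₁ - T.Q₂) ρ' = 0 := by
  obtain ⟨g, hg, hexp⟩ := Supermanifold.exists_isExp (neg_mem hψ)
  obtain ⟨g', -, hexp'⟩ := Supermanifold.exists_isExp (neg_mem (neg_mem hψ))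
  have hu : IsUnit g := by
    refine ⟨⟨g, g', hexp.mul_eq_one hexp', ?_⟩, rfl⟩
    rw [← SuperSpace.mul_comm_of_mem_even hg]
    exact hexp.mul_eq_one hexp'
  have e₁ := lieDerivative_rescale_eq_zero hψ (hQ₁ ▸ h₁) hexp hg hu
  have e₂ := lieDerivative_rescale_eq_zero hψ hQ₂ hexp hg hu
  refine ⟨ρ₁.rescale g hg hu, ?_, ?_⟩
  · rw [lieDerivative_add, e₁, e₂, add_zero]
  · rw [lieDerivative_sub, e₁, e₂, sub_zero]
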